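/- Let $M$ be a $\sigma$-compact (Hausdorff) finite-dimensional smooth manifold without boundary and let $V$ be a finite-dimensional real vector space. A saturated exhaustive sequence of $M$ is a sequence $(K_n)_{n\in\mathbb{N}}$ of compact equidimensional (i.e. codimension-zero) smooth submanifolds with boundary of $M$ such that $K_n\subseteq \mathring{K}_{n+1}$ for all $n$, $\bigcup_{n} K_n=M$, and for every $n$ no connected component of $M\setminus K_n$ is relatively compact in $M$. It is called strict if there is $N\in\mathbb{N}$ such that for all $n\ge N$ the canonical map $\pi_0(M\setminus K_{n+1})\to\pi_0(M\setminus K_n)$ is injective. Let $\Omega^1_c(M,V)$ be the space of compactly supported smooth $V$-valued $1$-forms on $M$, equipped with the locally convex inductive limit topology of the spaces $\Omega^1_K(M,V)$ of forms supported in $K$ ($K\subseteq M$ compact), each of which carries its $C^\infty$-topology (uniform convergence of all derivatives in charts on compact sets). Let $d\colon C^\infty_c(M,V)\to\Omega^1_c(M,V)$ be the differential, where $C^\infty_c(M,V)$ denotes the compactly supported smooth functions $M\to V$. If $M$ admits a strict saturated exhaustive sequence $(K_n)_{n\in\mathbb{N}}$, then the locally convex quotient space $\Omega^1_c(M,V)/dC^\infty_c(M,V)$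 is Hausdorff and complete (every Cauchy filter converges). -/

import Mathlib

open Set Topology Function
open scoped Manifold ContDiff Bundle

noncomputable section

namespace CompactForms

/-! ### Saturated exhaustive sequences -/

section Exhaustion

variable {E : Type*} [NormedAddCommGroup E] [NormedSpace ℝ E]
  {M : Type*} [TopologicalSpace M] [ChartedSpace E M]

variable (E) in
/-- `K` is a compact equidimensional (that is, codimension zero) smooth submanifold with boundary
of the boundaryless manifold `M` modelled on `E`: it is compact, and around every point of its
topological boundary some smooth chart of `M` maps it to a closed half space `{v | 0 ≤ ℓ v}`.
(Around an interior point of `K` there is nothing to require.) -/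
structure IsCompactDomain (K : Set M) : Prop where
  isCompact : IsCompact K
  exists_chart : ∀ x ∈ frontier K, ∃ φ ∈ IsManifold.maximalAtlas 𝓘(ℝ, E) ∞ M, x ∈ φ.source ∧
    ∃ ℓ : E →L[ℝ] ℝ, ℓ ≠ 0 ∧ ∀ y ∈ φ.source, y ∈ K ↔ 0 ≤ ℓ (φ y)

variable (E) in
/-- A saturated exhaustive sequence of the manifold `M`: compact codimension zero submanifolds
with boundary, each contained in the interior of the next one, covering `M`, and such that no
connected component of a complement `M \ K n` is relatively compact in `M`. -/
structure IsSaturatedExhaustive (K : ℕ → Set M) : Prop where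
  isCompactDomain : ∀ n, IsCompactDomain E (K n)
  subset_interior : ∀ n, K n ⊆ interior (K (n + 1))
  iUnion_eq : ⋃ n, K n = univ
  not_relativelyCompact : ∀ n, ∀ x ∈ (K n)ᶜ,
    ¬ IsCompact (closure (connectedComponentIn (K n)ᶜ x))

theorem IsSaturatedExhaustive.compl_subset {K : ℕ → Set M} (hK : IsSaturatedExhaustive E K)
    (n : ℕ) : (K (n + 1))ᶜ ⊆ (K n)ᶜ :=
  compl_subset_compl.2 ((hK.subset_interior n).trans interior_subset)

/-- The canonical map `π₀(M \ K (n + 1)) → π₀(M \ K n)` induced by the inclusion. -/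
def IsSaturatedExhaustive.componentMap {K : ℕ → Set M} (hK : IsSaturatedExhaustive E K) (n : ℕ) :
    ConnectedComponents ↥((K (n + 1))ᶜ) → ConnectedComponents ↥((K n)ᶜ) :=
  (continuous_inclusion (hK.compl_subset n)).connectedComponentsMap

/-- A saturated exhaustive sequence is strict if from some index on the canonical maps
`π₀(M \ K (n + 1)) → π₀(M \ K n)` are injective. -/
def IsSaturatedExhaustive.IsStrict {K : ℕ → Set M} (hK : IsSaturatedExhaustive E K) : Prop :=
  ∃ N : ℕ, ∀ n ≥ N, Injective (hK.componentMap n)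

end Exhaustion

/-! ### Smooth one-forms -/

variable (E : Type*) [NormedAddCommGroup E] [NormedSpace ℝ E]
  (M : Type*) [TopologicalSpace M] [ChartedSpace E M] [IsManifold 𝓘(ℝ, E) ∞ M]
  (V : Type*) [NormedAddCommGroup V] [NormedSpace ℝ V]

/-- `Ω¹(M, V)`: smooth sections of the bundle `Hom(TM, V)`. -/
abbrev OneForm : Type _ :=
  ContMDiffSection 𝓘(ℝ, E) (E →L[ℝ] V) ∞
    (fun x : M ↦ TangentSpace 𝓘(ℝ, E) x →L[ℝ] Bundle.Trivial M V x)

variable {E M V}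

/-- The support of a one-form. -/
def OneForm.support (θ : OneForm E M V) : Set M := closure {x | θ x ≠ 0}

/-- The expression of a one-form in the chart `φ`, that is, its pullback along `φ⁻¹`, as a
function on `E` (only its values on `φ.target` matter). -/
def OneForm.inChart (φ : OpenPartialHomeomorph M E) (θ : OneForm E M V) (v : E) : E →L[ℝ] V :=
  (θ (φ.symm v)).comp (mfderiv 𝓘(ℝ, E) 𝓘(ℝ, E) φ.symm v)

variable (E M V)

/-- The smooth (compact-open `C^∞`) topology on `Ω¹(M, V)`: uniform convergence, in every smooth
chart and on every compact subset of its target, of the iterated derivatives of all orders. -/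
@[reducible]
def OneForm.smoothTopology : TopologicalSpace (OneForm E M V) :=
  ⨅ (φ ∈ IsManifold.maximalAtlas 𝓘(ℝ, E) ∞ M) (k : ℕ),
    TopologicalSpace.induced
      (fun θ ↦ UniformOnFun.ofFun {C : Set E | IsCompact C ∧ C ⊆ φ.target}
        (iteratedFDeriv ℝ k (θ.inChart φ)))
      inferInstance

variable {M}

/-- `Ω¹_K(M, V)`: the one-forms with support in `K`. -/
def OneForm.supportedIn (K : Set M) : Submodule ℝ (OneForm E M V) where
  carrier := {θ | θ.support ⊆ K}
  zero_mem' := by simp [OneForm.support]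
  add_mem' {θ η} hθ hη := by
    have h : {x | (θ + η) x ≠ 0} ⊆ {x | θ x ≠ 0} ∪ {x | η x ≠ 0} := by
      intro x hx
      by_contra hc
      simp only [mem_union, mem_ofPred_eq, not_or, not_not] at hc
      exact hx (by rw [ContMDiffSection.coe_add, Pi.add_apply, hc.1, hc.2, add_zero])
    exact (closure_mono h).trans (closure_union.trans_subset (union_subset hθ hη))
  smul_mem' c θ hθ := by
    have h : {x | (c • θ) x ≠ 0} ⊆ {x | θ x ≠ 0} := by
      intro x hx hc
      exact hx (by rw [ContMDiffSection.coe_smul, Pi.smul_apply, hc, smul_zero])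
    exact (closure_mono h).trans hθ

/-- The topology of `Ω¹_K(M, V)`, induced by the smooth topology of `Ω¹(M, V)`. -/
@[reducible]
def OneForm.supportedInTopology (K : Set M) :
    TopologicalSpace (OneForm.supportedIn E V K) :=
  TopologicalSpace.induced Subtype.val (OneForm.smoothTopology E M V)

variable (M)

/-- `Ω¹_c(M, V)`: the one-forms with compact support. -/
def CompactOneForm : Submodule ℝ (OneForm E M V) where
  carrier := {θ | IsCompact θ.support}
  zero_mem' := by simp [OneForm.support]
  add_mem' {θ η} hθ hη :=
    (hθ.union hη).of_isClosed_subset isClosed_closure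
      ((OneForm.supportedIn E V (θ.support ∪ η.support)).add_mem
        (show θ.support ⊆ _ from subset_union_left) (show η.support ⊆ _ from subset_union_right))
  smul_mem' c θ hθ :=
    hθ.of_isClosed_subset isClosed_closure
      ((OneForm.supportedIn E V θ.support).smul_mem c (show θ.support ⊆ _ from subset_rfl))

variable {M}

/-- The inclusion `Ω¹_K(M, V) → Ω¹_c(M, V)` for compact `K`. -/
def CompactOneForm.ofSupportedIn {K : Set M} (hK : IsCompact K) :
    OneForm.supportedIn E V K → CompactOneForm E M V :=
  fun θ ↦ ⟨θ.1, hK.of_isClosed_subset isClosed_closure θ.2⟩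

variable (M)

/-- The locally convex inductive limit topology on `Ω¹_c(M, V)`: the finest locally convex vector
space topology for which all inclusions `Ω¹_K(M, V) → Ω¹_c(M, V)`, `K ⊆ M` compact, are
continuous. -/
instance CompactOneForm.topologicalSpace : TopologicalSpace (CompactOneForm E M V) :=
  sInf {t | (∀ (K : Set M) (hK : IsCompact K),
      @Continuous _ _ (OneForm.supportedInTopology E V K) t (CompactOneForm.ofSupportedIn E V hK)) ∧
    @IsTopologicalAddGroup (CompactOneForm E M V) t _ ∧
    @ContinuousSMul ℝ (CompactOneForm E M V) _ _ t ∧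
    @LocallyConvexSpace ℝ (CompactOneForm E M V) _ _ _ _ t}

instance : IsTopologicalAddGroup (CompactOneForm E M V) :=
  topologicalAddGroup_sInf fun _ ⟨_, ht, _, _⟩ ↦ ht

instance : ContinuousSMul ℝ (CompactOneForm E M V) :=
  continuousSMul_sInf fun _ ⟨_, _, ht, _⟩ ↦ ht

instance : LocallyConvexSpace ℝ (CompactOneForm E M V) :=
  .sInf fun _ ⟨_, _, _, ht⟩ ↦ ht

/-! ### Exact forms with compactly supported primitive -/

/-- `C^∞_c(M, V)`. -/
def CompactFunction : Submodule ℝ C^∞⟮𝓘(ℝ, E), M; 𝓘(ℝ, V), V⟯ where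
  carrier := {f | HasCompactSupport f}
  zero_mem' := by
    simp only [mem_ofPred_eq, ContMDiffMap.coe_zero]
    exact HasCompactSupport.zero
  add_mem' {f g} hf hg := by
    simp only [mem_ofPred_eq, ContMDiffMap.coe_add] at *
    exact hf.add hg
  smul_mem' c f hf := by
    simp only [mem_ofPred_eq, ContMDiffMap.coe_smul] at *
    exact hf.smul_left (f := fun _ ↦ c)

variable {E M V}

/-- The differential of a smooth `V`-valued function, as a smooth one-form. -/
def OneForm.ofFunction (f : C^∞⟮𝓘(ℝ, E), M; 𝓘(ℝ, V), V⟯) : OneForm E M V where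
  toFun x := mvfderiv 𝓘(ℝ, E) f x
  contMDiff_toFun := by
    intro x₀
    rw [contMDiffAt_hom_bundle]
    refine ⟨contMDiffAt_id, ?_⟩
    have h := (f.contMDiff x₀).mfderiv_const (m := ∞) (by simp)
    refine h.congr_of_eventuallyEq (Filter.Eventually.of_forall fun x ↦ ?_)
    ext v
    simp [inTangentCoordinates, ContinuousLinearMap.inCoordinates, mvfderiv]
    rfl

theorem OneForm.support_ofFunction_subset (f : C^∞⟮𝓘(ℝ, E), M; 𝓘(ℝ, V), V⟯) :
    (OneForm.ofFunction f).support ⊆ tsupport f := by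
  refine closure_minimal (fun x hx ↦ ?_) (isClosed_tsupport f)
  by_contra hc
  apply hx
  have h : (f : M → V) =ᶠ[𝓝 x] fun _ ↦ (0 : V) := notMem_tsupport_iff_eventuallyEq.1 hc
  change mvfderiv 𝓘(ℝ, E) f x = 0
  rw [mvfderiv, h.mfderiv_eq, mfderiv_const]
  exact ContinuousLinearMap.comp_zero _

variable (E M V)

/-- The differential `d : C^∞_c(M, V) → Ω¹_c(M, V)`. -/
def differential : CompactFunction E M V →ₗ[ℝ] CompactOneForm E M V where
  toFun f := ⟨OneForm.ofFunction f.1,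
    f.2.isCompact.of_isClosed_subset isClosed_closure (OneForm.support_ofFunction_subset f.1)⟩
  map_add' f g := by
    ext x v
    have hf := (f.1.contMDiff x).mdifferentiableAt (by simp)
    have hg := (g.1.contMDiff x).mdifferentiableAt (by simp)
    exact congrArg (fun L ↦ L v) (mfderiv_add hf hg)
  map_smul' c f := by
    ext x v
    have hf := (f.1.contMDiff x).mdifferentiableAt (by simp)
    exact congrArg (fun L ↦ L v) (const_smul_mfderiv hf c)

/-- `Ω¹_c(M, V) / d C^∞_c(M, V)` with the quotient topology. -/
abbrev CompactOneFormQuotient : Type _ :=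
  CompactOneForm E M V ⧸ LinearMap.range (differential E M V)

end CompactForms

end

/-!
The quotient `Ω¹_c(M, V) / d C^∞_c(M, V)` is shown to be a topological direct summand of
`Ω¹_c(M, V)`. Since `Ω¹_c(M, V)` is Hausdorff and complete, so is the quotient.

The complement is found by choosing primitives. Let `(K n)` be a saturated exhaustion. Because no
component of `M \ K n` is relatively compact, every point `x` outside `K n` can be joined to
infinity outside `K n` by a chain of coordinate balls. Integrating along this chain gives a linear
functional `c x` on `Ω¹_c(M, V)` which recovers `f x` from `d f` and vanishes on forms supported in `K n`.
Points of `K 0` are first joined to a point outside `K 0`, or, if their component of `M` is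
contained in `K 0`, to a base point of this component; in the latter case `f` is recovered only up
to a locally constant function (`IsSaturatedExhaustive.exists_functional`). On a coordinate ball
with centre `x`, integration of `θ` along the radii gives a smooth function with value `c x θ` at
`x`, which is a primitive of `θ` if `θ` is exact. These local functions are glued by a partition of
unity to a smooth function `Φ θ` (`gluedPrimitive`), which has compact support, depends
linearly on `θ`, and differs from `f` by a locally constant function if `θ = d f`. Thus `d ∘ Φ` is
a linear projection onto the exact forms (`IsSaturatedExhaustive.exists_projection`).

Continuity of `d ∘ Φ` is automatic. By the universal property of the inductive limit it is enough
to consider forms supported in a fixed compact set. They form a closed subspace of the Fréchet space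
`Ω¹(M, V)`, hence a barrelled space, and on a barrelled space a linear map to smooth functions is
continuous as soon as it is continuous at every point of `M`: derivatives are limits of difference
quotients (`exists_clm_eq_fderiv`), and a seminorm which is a supremum of continuous seminorms is
continuous (`OneForm.continuous_of_continuous_apply`). Hence no derivative of `Φ θ` has to be
estimated.

For the completeness of `Ω¹_c(M, V)`, a Cauchy filter converges in the Fréchet space `Ω¹(M, V)`.
Sums of seminorms of the products with the members of a partition of unity, arbitrarily weighted,
are continuous on `Ω¹_c(M, V)` (`CompactOneForm.exists_continuous_seminorm`). Controlling these
shows that the limit has compact support and that convergence takes place in `Ω¹_c(M, V)`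
(`completeSpace_of_partition`).
-/

noncomputable section

namespace CompactForms

open Filter TopologicalSpace

/-! ### Calculus on open subsets of a normed space -/

section Calculus

variable {E F : Type*} [NormedAddCommGroup E] [NormedSpace ℝ E]
  [NormedAddCommGroup F] [NormedSpace ℝ F] {U : Set E} {f : E → F}

theorem differentiableAt_iteratedFDeriv_of_contDiffOn (hU : IsOpen U) (hf : ContDiffOn ℝ ∞ f U)
    (k : ℕ) {x : E} (hx : x ∈ U) : DifferentiableAt ℝ (iteratedFDeriv ℝ k f) x := by
  have h : ContDiffAt ℝ ∞ f x := hf.contDiffAt (hU.mem_nhds hx)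
  exact h.differentiableAt_iteratedFDeriv (by exact_mod_cast ENat.natCast_lt_top k)

theorem hasFDerivAt_iteratedFDeriv_of_contDiffOn (hU : IsOpen U) (hf : ContDiffOn ℝ ∞ f U)
    (k : ℕ) {x : E} (hx : x ∈ U) :
    HasFDerivAt (iteratedFDeriv ℝ k f) (iteratedFDeriv ℝ (k + 1) f x).curryLeft x := by
  have h := (differentiableAt_iteratedFDeriv_of_contDiffOn hU hf k hx).hasFDerivAt
  convert! h using 1

theorem continuousOn_iteratedFDeriv_of_contDiffOn (hU : IsOpen U) (hf : ContDiffOn ℝ ∞ f U)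
    (k : ℕ) : ContinuousOn (iteratedFDeriv ℝ k f) U := fun _ hx ↦
  (differentiableAt_iteratedFDeriv_of_contDiffOn hU hf k hx).continuousAt.continuousWithinAt

/-- A formal Taylor series on an open set, all of whose terms are differentiable with the expected
derivative, is the Taylor series of its zeroth term, which therefore is smooth. -/
theorem contDiffOn_of_hasFDerivAt_curryLeft (hU : IsOpen U) {p : E → FormalMultilinearSeries ℝ E F}
    (h0 : ∀ x ∈ U, (p x 0).curry0 = f x)
    (hp : ∀ k : ℕ, ∀ x ∈ U, HasFDerivAt (fun y ↦ p y k) (p x (k + 1)).curryLeft x) :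
    ContDiffOn ℝ ∞ f U ∧ ∀ k : ℕ, ∀ x ∈ U, iteratedFDeriv ℝ k f x = p x k := by
  have h : HasFTaylorSeriesUpToOn ∞ f p U :=
    ⟨h0, fun k _ x hx ↦ (hp k x hx).hasFDerivWithinAt,
      fun k _ x hx ↦ (hp k x hx).continuousAt.continuousWithinAt⟩
  refine ⟨h.contDiffOn, fun k x hx ↦ ?_⟩
  rw [← iteratedFDerivWithin_of_isOpen k hU hx]
  exact (h.eq_iteratedFDerivWithin_of_uniqueDiffOn (by exact_mod_cast le_top)
    hU.uniqueDiffOn hx).symm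

/-- A sequence of smooth functions all of whose derivatives are uniformly Cauchy converges,
together with all derivatives, uniformly to a smooth function. -/
theorem exists_contDiffOn_tendstoUniformlyOn [CompleteSpace F] (hU : IsOpen U) {u : ℕ → E → F}
    (hu : ∀ n, ContDiffOn ℝ ∞ (u n) U)
    (hC : ∀ k : ℕ, UniformCauchySeqOn (fun n ↦ iteratedFDeriv ℝ k (u n)) atTop U) :
    ∃ g : E → F, ContDiffOn ℝ ∞ g U ∧
      ∀ k : ℕ, TendstoUniformlyOn (fun n ↦ iteratedFDeriv ℝ k (u n)) (iteratedFDeriv ℝ k g)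
        atTop U := by
  have hlim : ∀ k : ℕ, ∀ x, ∃ G : E [×k]→L[ℝ] F, x ∈ U →
      Tendsto (fun n ↦ iteratedFDeriv ℝ k (u n) x) atTop (𝓝 G) := by
    intro k x
    by_cases hx : x ∈ U
    · obtain ⟨G, hG⟩ := cauchySeq_tendsto_of_complete ((hC k).cauchySeq hx)
      exact ⟨G, fun _ ↦ hG⟩
    · exact ⟨0, fun h ↦ absurd h hx⟩
  choose G hG using hlim
  have hunif : ∀ k, TendstoUniformlyOn (fun n ↦ iteratedFDeriv ℝ k (u n)) (G k) atTop U :=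
    fun k ↦ (hC k).tendstoUniformlyOn_of_tendsto fun x hx ↦ hG k x hx
  have key := contDiffOn_of_hasFDerivAt_curryLeft (f := fun x ↦ (G 0 x).curry0)
    (p := fun x k ↦ G k x) hU (fun _ _ ↦ rfl) (fun k x hx ↦ by
      refine hasFDerivAt_of_tendstoUniformlyOn (l := atTop)
        (g' := fun y ↦ (G (k + 1) y).curryLeft)
        (f' := fun n y ↦ (iteratedFDeriv ℝ (k + 1) (u n) y).curryLeft) hU ?_
        (fun n y hy ↦ hasFDerivAt_iteratedFDeriv_of_contDiffOn hU (hu n) k hy)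
        (fun y hy ↦ hG k y hy) hx
      have h := (continuousMultilinearCurryLeftEquiv ℝ (fun _ : Fin (k + 1) ↦ E)
        F).isometry.uniformContinuous.comp_tendstoUniformlyOn (hunif (k + 1))
      exact h)
  refine ⟨_, key.1, fun k ↦ (hunif k).congr_right fun x hx ↦ (key.2 k x hx).symm⟩

end Calculus

section StarPrimitive

variable {E : Type*} [NormedAddCommGroup E] [NormedSpace ℝ E] {c : E} {r : ℝ}

theorem add_smul_sub_mem_ball {ρ : ℝ} {y : E} (hy : y ∈ Metric.ball c ρ) {t : ℝ}
    (ht : t ∈ Icc (0 : ℝ) 1) : c + t • (y - c) ∈ Metric.ball c ρ := by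
  rw [Metric.mem_ball, dist_eq_norm] at *
  rw [add_sub_cancel_left, norm_smul, Real.norm_of_nonneg ht.1]
  exact (mul_le_of_le_one_left (norm_nonneg _) ht.2).trans_lt hy

theorem continuousOn_comp_ray {F : Type*} [TopologicalSpace F] {g : E → F}
    (hg : ContinuousOn g (Metric.ball c r)) {y : E}
    (hy : y ∈ Metric.ball c r) : ContinuousOn (fun t : ℝ ↦ g (c + t • (y - c))) (Icc 0 1) :=
  hg.comp (by fun_prop) fun _ ht ↦ add_smul_sub_mem_ball hy ht

variable {F : Type*} [NormedAddCommGroup F] [NormedSpace ℝ F] [FiniteDimensional ℝ E]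

theorem hasFDerivAt_integral_ray {g : E → F} {g' : E → E →L[ℝ] F}
    (hg : ∀ y ∈ Metric.ball c r, HasFDerivAt g (g' y) y)
    (hg' : ContinuousOn g' (Metric.ball c r)) (a : ℕ) {y : E} (hy : y ∈ Metric.ball c r) :
    HasFDerivAt (fun y ↦ ∫ t in (0 : ℝ)..1, t ^ a • g (c + t • (y - c)))
      (∫ t in (0 : ℝ)..1, t ^ (a + 1) • g' (c + t • (y - c))) y := by
  have hgc : ContinuousOn g (Metric.ball c r) := fun z hz ↦
    (hg z hz).continuousAt.continuousWithinAt
  obtain ⟨ρ, hyρ, hρr⟩ := exists_between (Metric.mem_ball.1 hy)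
  obtain ⟨B, hB⟩ := (isCompact_closedBall c ρ).exists_bound_of_continuousOn
    (hg'.mono (Metric.closedBall_subset_ball hρr))
  have hsub : Metric.ball c ρ ⊆ Metric.ball c r := Metric.ball_subset_ball hρr.le
  have hmem : ∀ t : ℝ, t ∈ uIoc (0 : ℝ) 1 → t ∈ Icc (0 : ℝ) 1 := fun t ht ↦ by
    rw [uIoc_of_le zero_le_one] at ht
    exact Ioc_subset_Icc_self ht
  refine intervalIntegral.hasFDerivAt_integral_of_dominated_of_fderiv_le (bound := fun _ ↦ B)
    (F' := fun y t ↦ t ^ (a + 1) • g' (c + t • (y - c)))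
    (Metric.isOpen_ball.mem_nhds (Metric.mem_ball.2 hyρ)) ?_ ?_ ?_ ?_ ?_ ?_
  · filter_upwards [Metric.isOpen_ball.mem_nhds hy] with z hz
    have h := ((continuousOn_pow a).smul (continuousOn_comp_ray hgc hz))
    rw [uIoc_of_le zero_le_one]
    exact (h.mono Ioc_subset_Icc_self).aestronglyMeasurable measurableSet_Ioc
  · exact ContinuousOn.intervalIntegrable_of_Icc zero_le_one
      ((continuousOn_pow a).smul (continuousOn_comp_ray hgc hy))
  · have h := ((continuousOn_pow (a + 1)).smul (continuousOn_comp_ray hg' hy))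
    rw [uIoc_of_le zero_le_one]
    exact (h.mono Ioc_subset_Icc_self).aestronglyMeasurable measurableSet_Ioc
  · refine Eventually.of_forall fun t ht z hz ↦ ?_
    have ht' := hmem t ht
    rw [norm_smul, norm_pow, Real.norm_of_nonneg ht'.1]
    exact (mul_le_of_le_one_left (norm_nonneg _) (pow_le_one₀ ht'.1 ht'.2)).trans
      (hB _ (Metric.ball_subset_closedBall (add_smul_sub_mem_ball hz ht')))
  · exact intervalIntegrable_const
  · refine Eventually.of_forall fun t ht z hz ↦ ?_
    have h1 := hg _ (add_smul_sub_mem_ball (hsub hz) (hmem t ht))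
    have h2 : HasFDerivAt (fun z : E ↦ c + t • (z - c)) (t • ContinuousLinearMap.id ℝ E) z :=
      (((hasFDerivAt_id z).sub_const c).const_smul t).const_add c
    convert! (h1.comp z h2).const_smul (t ^ a) using 1
    ext v
    simp [pow_succ, smul_smul]

set_option synthInstance.maxHeartbeats 200000 in
/-- The mean of a smooth function along the segments issuing from the centre of a ball is smooth
on this ball. -/
theorem contDiffOn_integral_ray [CompleteSpace F] {g : E → F}
    (hg : ContDiffOn ℝ ∞ g (Metric.ball c r)) :
    ContDiffOn ℝ ∞ (fun y ↦ ∫ t in (0 : ℝ)..1, g (c + t • (y - c))) (Metric.ball c r) := by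
  refine (contDiffOn_of_hasFDerivAt_curryLeft Metric.isOpen_ball
    (p := fun y k ↦ ∫ t in (0 : ℝ)..1, t ^ k • iteratedFDeriv ℝ k g (c + t • (y - c)))
    (fun y hy ↦ ?_) (fun k y hy ↦ ?_)).1
  · have h := (continuousMultilinearCurryFin0 ℝ E F).toContinuousLinearEquiv.toContinuousLinearMap
      |>.intervalIntegral_comp_comm (μ := MeasureTheory.volume) (a := 0) (b := 1)
        (f := fun t : ℝ ↦ t ^ 0 • iteratedFDeriv ℝ 0 g (c + t • (y - c)))
        (ContinuousOn.intervalIntegrable_of_Icc zero_le_one ((continuousOn_pow 0).smul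
          (continuousOn_comp_ray (continuousOn_iteratedFDeriv_of_contDiffOn
            Metric.isOpen_ball hg 0) hy)))
    refine Eq.trans h.symm ?_
    congr 1
    ext t
    simp
  · have h := hasFDerivAt_integral_ray (c := c) (r := r)
      (fun z hz ↦ hasFDerivAt_iteratedFDeriv_of_contDiffOn Metric.isOpen_ball hg k hz)
      ((continuousMultilinearCurryLeftEquiv ℝ (fun _ : Fin (k + 1) ↦ E)
        F).continuous.comp_continuousOn
        (continuousOn_iteratedFDeriv_of_contDiffOn Metric.isOpen_ball hg (k + 1))) k hy
    convert! h using 1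
    let L : (E [×(k + 1)]→L[ℝ] F) →L[ℝ] (E →L[ℝ] E [×k]→L[ℝ] F) :=
      (continuousMultilinearCurryLeftEquiv ℝ (fun _ : Fin (k + 1) ↦ E)
        F).toContinuousLinearEquiv.toContinuousLinearMap
    have h := ContinuousLinearMap.intervalIntegral_comp_comm (𝕜 := ℝ)
        (F := E →L[ℝ] E [×k]→L[ℝ] F) L (μ := MeasureTheory.volume) (a := 0) (b := 1)
        (f := fun t : ℝ ↦ t ^ (k + 1) • iteratedFDeriv ℝ (k + 1) g (c + t • (y - c)))
        (ContinuousOn.intervalIntegrable_of_Icc zero_le_one ((continuousOn_pow (k + 1)).smul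
          (continuousOn_comp_ray (continuousOn_iteratedFDeriv_of_contDiffOn
            Metric.isOpen_ball hg (k + 1)) hy)))
    refine Eq.trans h.symm ?_
    congr 1

end StarPrimitive

/-! ### Derivatives of families depending linearly on a barrelled parameter -/

section Barrelled

variable {X E F : Type*} [AddCommGroup X] [Module ℝ X] [TopologicalSpace X]
  [IsTopologicalAddGroup X] [ContinuousSMul ℝ X] [BarrelledSpace ℝ X]
  [NormedAddCommGroup E] [NormedSpace ℝ E] [FiniteDimensional ℝ E]
  [NormedAddCommGroup F] [NormedSpace ℝ F] {T : Set E} {G : X → E → F}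

/-- If functions depend linearly on a parameter in a barrelled space, and if their values depend
continuously on it, then so do their derivatives, as limits of difference quotients
(Banach–Steinhaus). -/
theorem exists_clm_eq_fderiv (hT : IsOpen T) (hd : ∀ θ, ∀ y ∈ T, DifferentiableAt ℝ (G θ) y)
    (hG : ∀ y ∈ T, ∃ l : X →L[ℝ] F, ∀ θ, l θ = G θ y) {y : E} (hy : y ∈ T) :
    ∃ l : X →L[ℝ] E →L[ℝ] F, ∀ θ, l θ = fderiv ℝ (G θ) y := by
  let _ : UniformSpace X := IsTopologicalAddGroup.rightUniformSpace X
  have : IsUniformAddGroup X := isUniformAddGroup_of_addCommGroup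
  have hG' : ∀ z, ∃ l : X →L[ℝ] F, z ∈ T → ∀ θ, l θ = G θ z := fun z ↦ by
    by_cases hz : z ∈ T
    · obtain ⟨l, hl⟩ := hG z hz
      exact ⟨l, fun _ ↦ hl⟩
    · exact ⟨0, fun h ↦ absurd h hz⟩
  choose l hl using hG'
  have hdir : ∀ w : E, ∃ m : X →L[ℝ] F, ∀ θ, m θ = fderiv ℝ (G θ) y w := by
    intro w
    have h0 : Tendsto (fun n : ℕ ↦ ((n : ℝ) + 1)⁻¹ • w) atTop (𝓝 0) := by
      have h := (tendsto_one_div_add_atTop_nhds_zero_nat (𝕜 := ℝ)).smul_const w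
      simpa using h
    have hev : ∀ᶠ n : ℕ in atTop, y + ((n : ℝ) + 1)⁻¹ • w ∈ T := by
      have h := (tendsto_const_nhds (x := y)).add h0
      rw [add_zero] at h
      exact h.eventually (hT.mem_nhds hy)
    have hlim : Tendsto (fun (n : ℕ) θ ↦
        (((n : ℝ) + 1) • (l (y + ((n : ℝ) + 1)⁻¹ • w) - l y)) θ) atTop
        (𝓝 fun θ ↦ fderiv ℝ (G θ) y w) := by
      rw [tendsto_pi_nhds]
      intro θ
      have h := (hd θ y hy).hasFDerivAt.lim (l := atTop) w (c := fun n : ℕ ↦ (n : ℝ) + 1) ?_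
      · refine h.congr' ?_
        filter_upwards [hev] with n hn
        simp [hl _ hn θ, hl y hy θ]
      · exact tendsto_norm_atTop_atTop.comp
          (tendsto_atTop_add_const_right _ _ tendsto_natCast_atTop_atTop)
    exact ⟨continuousLinearMapOfTendsto _ hlim, fun θ ↦ rfl⟩
  choose m hm using hdir
  refine ⟨⟨⟨⟨fun θ ↦ fderiv ℝ (G θ) y, fun θ η ↦ ?_⟩, fun a θ ↦ ?_⟩, ?_⟩, fun θ ↦ rfl⟩
  · ext w
    simp [← hm]
  · ext w
    simp [← hm]
  · refine continuous_clm_apply.2 fun w ↦ ?_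
    exact (m w).continuous.congr fun θ ↦ hm w θ

set_option synthInstance.maxHeartbeats 200000 in
theorem exists_clm_eq_iteratedFDeriv (hT : IsOpen T) (hd : ∀ θ, ContDiffOn ℝ ∞ (G θ) T)
    (hG : ∀ y ∈ T, ∃ l : X →L[ℝ] F, ∀ θ, l θ = G θ y) (k : ℕ) :
    ∀ y ∈ T, ∃ l : X →L[ℝ] E [×k]→L[ℝ] F, ∀ θ, l θ = iteratedFDeriv ℝ k (G θ) y := by
  induction k with
  | zero =>
    intro y hy
    obtain ⟨l, hl⟩ := hG y hy
    refine ⟨((continuousMultilinearCurryFin0 ℝ E F).symm.toContinuousLinearEquiv :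
      F →L[ℝ] E [×0]→L[ℝ] F).comp l, fun θ ↦ ?_⟩
    ext v
    simp [hl]
  | succ k ih =>
    intro y hy
    obtain ⟨l, hl⟩ := exists_clm_eq_fderiv hT
      (fun θ z hz ↦ differentiableAt_iteratedFDeriv_of_contDiffOn hT (hd θ) k hz) ih hy
    refine ⟨((continuousMultilinearCurryLeftEquiv ℝ (fun _ : Fin (k + 1) ↦ E)
      F).symm.toContinuousLinearEquiv :
        (E →L[ℝ] E [×k]→L[ℝ] F) →L[ℝ] E [×(k + 1)]→L[ℝ] F).comp l, fun θ ↦ ?_⟩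
    rw [iteratedFDeriv_succ_eq_comp_left]
    simp [hl]
    rfl

end Barrelled

/-! ### Completeness criteria -/

section Frechet

variable {ι X : Type*} [Countable ι] [AddCommGroup X] [Module ℝ X] [TopologicalSpace X]
  [IsTopologicalAddGroup X] {q : SeminormFamily ℝ X ι}

theorem completeSpace_of_countable_withSeminorms (hq : WithSeminorms q)
    (h : ∀ u : ℕ → X, (∀ i, ∀ ε > 0, ∃ N, ∀ m ≥ N, ∀ n ≥ N, q i (u m - u n) < ε) →
      ∃ x, ∀ i, ∀ ε > 0, ∃ N, ∀ n ≥ N, q i (u n - x) < ε) :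
    @CompleteSpace X (IsTopologicalAddGroup.rightUniformSpace X) ∧
      IsCompletelyPseudoMetrizableSpace X := by
  let _ : UniformSpace X := IsTopologicalAddGroup.rightUniformSpace X
  have : IsUniformAddGroup X := isUniformAddGroup_of_addCommGroup
  have := hq.firstCountableTopology
  have hc : (uniformity X).IsCountablyGenerated := by
    rw [uniformity_eq_comap_nhds_zero]
    infer_instance
  have : CompleteSpace X := by
    refine UniformSpace.complete_of_cauchySeq_tendsto fun u hu ↦ ?_
    obtain ⟨x, hx⟩ := h u (fun i ε hε ↦ by
      have hU : {p : X × X | q i (p.1 - p.2) < ε} ∈ uniformity X := by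
        rw [uniformity_eq_comap_nhds_zero_swapped]
        refine preimage_mem_comap (m := fun p : X × X ↦ p.1 - p.2) (t := {z | q i z < ε}) ?_
        refine (isOpen_lt (hq.continuous_seminorm i) continuous_const).mem_nhds ?_
        simpa using hε
      obtain ⟨N, hN⟩ := (cauchySeq_iff.1 hu) _ hU
      exact ⟨N, fun m hm n hn ↦ hN m hm n hn⟩)
    refine ⟨x, (hq.tendsto_nhds u x).2 fun i ε hε ↦ ?_⟩
    obtain ⟨N, hN⟩ := hx i ε hε
    exact eventually_atTop.2 ⟨N, hN⟩
  exact ⟨this, IsCompletelyPseudoMetrizableSpace.of_completeSpace_pseudometrizable⟩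

/-- A countable complete family of continuous seminorms defines the given topology as soon as the
given topology is coarser than every barrelled topology for which these seminorms are
continuous. -/
theorem withSeminorms_of_barrelled_le {X : Type*} [AddCommGroup X] [Module ℝ X]
    [s : TopologicalSpace X] [IsTopologicalAddGroup X] [ContinuousSMul ℝ X]
    {q : SeminormFamily ℝ X ι} (hq : ∀ i, Continuous (q i))
    (h : ∀ u : ℕ → X, (∀ i, ∀ ε > 0, ∃ N, ∀ m ≥ N, ∀ n ≥ N, q i (u m - u n) < ε) →
      ∃ x, ∀ i, ∀ ε > 0, ∃ N, ∀ n ≥ N, q i (u n - x) < ε)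
    (hle : ∀ t : TopologicalSpace X, @IsTopologicalAddGroup X t _ → @ContinuousSMul ℝ X _ _ t →
      @BarrelledSpace ℝ X _ _ _ t → (∀ i, @Continuous _ _ t _ (q i)) →
      t ≤ s) :
    WithSeminorms q := by
  refine ⟨le_antisymm ?_ ?_⟩
  · have hw : @WithSeminorms _ _ _ _ _ _ q q.moduleFilterBasis.topology :=
      @WithSeminorms.mk _ _ _ _ _ _ _ (_) rfl
    exact continuous_id_iff_le.1 (@WithSeminorms.continuous_of_continuous_comp ℝ ℝ X X ι _ _ _
      _ _ _ (RingHom.id ℝ) _ q _ _ (_) hw LinearMap.id hq)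
  · let _ := q.moduleFilterBasis.topology
    have hw : WithSeminorms q := ⟨rfl⟩
    have h1 := hw.topologicalAddGroup
    have h2 := hw.continuousSMul
    have := (completeSpace_of_countable_withSeminorms hw h).2
    exact hle _ h1 h2 inferInstance fun i ↦ hw.continuous_seminorm i

end Frechet

section Partition

variable {ι X Y : Type*} [AddCommGroup X] [Module ℝ X] [UniformSpace X] [IsUniformAddGroup X]
  [CompleteSpace X]
  [AddCommGroup Y] [Module ℝ Y] [UniformSpace Y] [IsUniformAddGroup Y] [ContinuousSMul ℝ Y]
  [LocallyConvexSpace ℝ Y] [T2Space Y]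

/-- Completeness of a locally convex space `Y` that is mapped by `j` into a complete space `X` and
that is cut into pieces by a locally finite partition of unity `m i : X → Y`, provided that the
seminorms of `Y` contain all sums of seminorms of `X` that are carried by the pieces. -/
theorem completeSpace_of_partition (j : Y →L[ℝ] X) (m : ι → X →L[ℝ] Y)
    (hfin : ∀ y, {i | m i (j y) ≠ 0}.Finite) (hsum : ∀ y, ∑ᶠ i, m i (j y) = y)
    (hrange : ∀ x, {i | m i x ≠ 0}.Finite → x ∈ range j)
    (hsemi : ∀ r : ι → Seminorm ℝ X, (∀ i, Continuous (r i)) → (∀ i x, m i x = 0 → r i x = 0) →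
      ∃ q : Seminorm ℝ Y, Continuous q ∧ ∀ y, ∀ s : Finset ι, ∑ i ∈ s, r i (j y) ≤ q y) :
    CompleteSpace Y := by
  refine ⟨fun {f} hf ↦ ?_⟩
  have := hf.1
  obtain ⟨x, hx⟩ := CompleteSpace.complete (hf.map j.uniformContinuous)
  have hjx : Tendsto j f (𝓝 x) := hx
  have key : ∀ r : ι → Seminorm ℝ X, (∀ i, Continuous (r i)) → (∀ i x, m i x = 0 → r i x = 0) →
      ∀ ε > 0, ∀ᶠ a in f, ∀ s : Finset ι, ∑ i ∈ s, r i (j a - x) ≤ ε := by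
    intro r hr hr0 ε hε
    obtain ⟨q, hq, hqr⟩ := hsemi r hr hr0
    have hU : {p : Y × Y | q (p.1 - p.2) < ε} ∈ uniformity Y := by
      rw [uniformity_eq_comap_nhds_zero_swapped]
      refine preimage_mem_comap (m := fun p : Y × Y ↦ p.1 - p.2) (t := {z | q z < ε}) ?_
      refine (isOpen_lt hq continuous_const).mem_nhds ?_
      simpa using hε
    obtain ⟨A, hA, hAU⟩ := (cauchy_iff.1 hf).2 _ hU
    filter_upwards [hA] with a ha s
    have hlim : Tendsto (fun b ↦ ∑ i ∈ s, r i (j a - j b)) f (𝓝 (∑ i ∈ s, r i (j a - x))) :=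
      tendsto_finsetSum _ fun i _ ↦ ((hr i).tendsto _).comp (hjx.const_sub (j a))
    refine le_of_tendsto hlim ?_
    filter_upwards [hA] with b hb
    have h := hqr (a - b) s
    simp only [map_sub] at h
    exact h.trans (hAU (mk_mem_prod ha hb)).le
  have hY := PolynormableSpace.withSeminorms ℝ Y
  have hcomp : ∀ p : Seminorm ℝ Y, Continuous p → ∀ i,
      Continuous (p.comp (m i).toLinearMap) := fun p hp i ↦ hp.comp (m i).continuous
  -- Weights normalised on the pieces of `x`: an element near `x` has to meet almost all of them.
  have hxr : {i | m i x ≠ 0}.Finite := by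
    have hex : ∀ i, ∃ p : Seminorm ℝ Y, Continuous p ∧ (m i x ≠ 0 → p (m i x) = 2) := by
      intro i
      by_cases hi : m i x = 0
      · exact ⟨0, continuous_const, fun h ↦ absurd hi h⟩
      · obtain ⟨p, hp⟩ := hY.separating_of_T1 (m i x) hi
        have hpos : 0 < p.1 (m i x) := lt_of_le_of_ne (apply_nonneg _ _) (Ne.symm hp)
        let c : NNReal := ⟨2 / p.1 (m i x), by positivity⟩
        refine ⟨c • (p.1 : Seminorm ℝ Y), ?_, fun _ ↦ ?_⟩
        · exact continuous_const.mul p.2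
        · change 2 / p.1 (m i x) * p.1 (m i x) = 2
          field_simp
    choose p hp hpx using hex
    obtain ⟨a, ha⟩ := (key (fun i ↦ (p i).comp (m i).toLinearMap) (fun i ↦ hcomp _ (hp i) i)
      (fun i x hi ↦ by simp [hi]) 1 one_pos).exists
    refine (hfin a).subset fun i hi ↦ ?_
    by_contra hai
    have h := ha {i}
    have hai' : m i (j a) = 0 := not_not.1 hai
    have h2 := hpx i hi
    simp only [Finset.sum_singleton, Seminorm.comp_apply, ContinuousLinearMap.coe_coe, map_sub,
      hai', zero_sub, map_neg_eq_map, h2] at h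
    norm_num at h
  obtain ⟨y, rfl⟩ := hrange x hxr
  refine ⟨y, ?_⟩
  have : Tendsto id f (𝓝 y) := by
    rw [hY.tendsto_nhds]
    intro p ε hε
    filter_upwards [key (fun i ↦ p.1.comp (m i).toLinearMap) (fun i ↦ hcomp _ p.2 i)
      (fun i x hi ↦ by simp [hi]) (ε / 2) (half_pos hε)] with a ha
    refine lt_of_le_of_lt ?_ (half_lt_self hε)
    have hs := hfin (a - y)
    have h1 : (a - y) = ∑ i ∈ hs.toFinset, m i (j (a - y)) := by
      conv_lhs => rw [← hsum (a - y)]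
      exact finsum_eq_sum_of_support_subset _ (by simp [Function.support])
    have h2 := ha hs.toFinset
    simp only [Seminorm.comp_apply, ContinuousLinearMap.coe_coe] at h2
    rw [← map_sub j] at h2
    rw [id, h1]
    exact (Finset.le_sum_of_subadditive p.1 (map_zero _).le (map_add_le_add _) _ _).trans h2
  exact this

end Partition

/-! ### One-forms in charts -/

section Charts

variable {E : Type*} [NormedAddCommGroup E] [NormedSpace ℝ E]
  {M : Type*} [TopologicalSpace M] [ChartedSpace E M] {φ : OpenPartialHomeomorph M E}

theorem mdifferentiable_of_mem_maximalAtlas (hφ : φ ∈ IsManifold.maximalAtlas 𝓘(ℝ, E) ∞ M) :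
    φ.MDifferentiable 𝓘(ℝ, E) 𝓘(ℝ, E) :=
  ⟨(contMDiffOn_of_mem_maximalAtlas hφ).mdifferentiableOn (by simp),
    (contMDiffOn_symm_of_mem_maximalAtlas hφ).mdifferentiableOn (by simp)⟩

variable [IsManifold 𝓘(ℝ, E) ∞ M] {V : Type*} [NormedAddCommGroup V] [NormedSpace ℝ V]

theorem OneForm.inChart_add (φ : OpenPartialHomeomorph M E) (θ η : OneForm E M V) (v : E) :
    (θ + η).inChart φ v = θ.inChart φ v + η.inChart φ v := rfl

theorem OneForm.inChart_smul (φ : OpenPartialHomeomorph M E) (a : ℝ) (θ : OneForm E M V) (v : E) :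
    (a • θ).inChart φ v = a • θ.inChart φ v := rfl

theorem OneForm.inChart_apply_mfderiv (hφ : φ ∈ IsManifold.maximalAtlas 𝓘(ℝ, E) ∞ M)
    (θ : OneForm E M V) {x : M} (hx : x ∈ φ.source) :
    (θ.inChart φ (φ x)).comp (mfderiv 𝓘(ℝ, E) 𝓘(ℝ, E) φ x) = θ x := by
  have h := (mdifferentiable_of_mem_maximalAtlas hφ).symm_comp_deriv hx
  ext w
  have h2 := congrArg (fun L ↦ L w) h
  change θ (φ.symm (φ x)) (mfderiv 𝓘(ℝ, E) 𝓘(ℝ, E) φ.symm (φ x)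
    (mfderiv 𝓘(ℝ, E) 𝓘(ℝ, E) φ x w)) = θ x w
  have h3 : mfderiv 𝓘(ℝ, E) 𝓘(ℝ, E) φ.symm (φ x) (mfderiv 𝓘(ℝ, E) 𝓘(ℝ, E) φ x w) = w := h2
  rw [h3]
  have h4 : ∀ y : M, y = x → θ y w = θ x w := by
    rintro _ rfl
    rfl
  exact h4 _ (φ.left_inv hx)

theorem contMDiffAt_of_eventually_eq_comp_mfderiv {x₀ : M}
    {θ : ∀ x : M, TangentSpace 𝓘(ℝ, E) x →L[ℝ] Bundle.Trivial M V x}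
    {g : M → E →L[ℝ] V} {φ : OpenPartialHomeomorph M E}
    (hφ : φ ∈ IsManifold.maximalAtlas 𝓘(ℝ, E) ∞ M) (hx : x₀ ∈ φ.source)
    (hg : ContMDiffAt 𝓘(ℝ, E) 𝓘(ℝ, E →L[ℝ] V) ∞ g x₀)
    (hθ : ∀ᶠ x in 𝓝 x₀, θ x = (g x).comp (mfderiv 𝓘(ℝ, E) 𝓘(ℝ, E) φ x)) :
    ContMDiffAt 𝓘(ℝ, E) (𝓘(ℝ, E).prod 𝓘(ℝ, E →L[ℝ] V)) ∞
      (fun x ↦ Bundle.TotalSpace.mk' (E →L[ℝ] V)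
        (E := fun x : M ↦ TangentSpace 𝓘(ℝ, E) x →L[ℝ] Bundle.Trivial M V x) x (θ x)) x₀ := by
  rw [contMDiffAt_hom_bundle]
  refine ⟨contMDiffAt_id, ?_⟩
  have h := (contMDiffAt_of_mem_maximalAtlas hφ hx).mfderiv_const (m := ∞) (by simp)
  refine (hg.clm_comp h).congr_of_eventuallyEq ?_
  filter_upwards [hθ] with x hx
  ext v
  simp [hx, inTangentCoordinates, ContinuousLinearMap.inCoordinates]
  rfl

theorem OneForm.contDiffOn_inChart [FiniteDimensional ℝ E]
    (hφ : φ ∈ IsManifold.maximalAtlas 𝓘(ℝ, E) ∞ M) (θ : OneForm E M V) :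
    ContDiffOn ℝ ∞ (θ.inChart φ) φ.target := by
  refine contDiffOn_clm_apply.2 fun w v hv ↦ ?_
  refine ContDiffAt.contDiffWithinAt ?_
  have h1 : ContMDiffAt 𝓘(ℝ, E) (𝓘(ℝ, E).prod 𝓘(ℝ, E →L[ℝ] V)) ∞
      (fun v ↦ Bundle.TotalSpace.mk' (E →L[ℝ] V)
        (E := fun x : M ↦ TangentSpace 𝓘(ℝ, E) x →L[ℝ] Bundle.Trivial M V x) (φ.symm v)
        (θ (φ.symm v))) v :=
    (θ.contMDiff (φ.symm v)).comp v (contMDiffAt_symm_of_mem_maximalAtlas hφ hv)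
  have h2 : ContMDiffAt 𝓘(ℝ, E) (𝓘(ℝ, E).prod 𝓘(ℝ, E)) ∞
      (fun v ↦ Bundle.TotalSpace.mk' E (E := fun x : M ↦ TangentSpace 𝓘(ℝ, E) x) (φ.symm v)
        (mfderiv 𝓘(ℝ, E) 𝓘(ℝ, E) φ.symm v w)) v := by
    have h := (contMDiffOn_symm_of_mem_maximalAtlas hφ).contMDiffOn_tangentMapWithin (m := ∞)
      (by simp) φ.open_target.uniqueMDiffOn
    have hc : ContMDiffAt 𝓘(ℝ, E) (𝓘(ℝ, E).prod 𝓘(ℝ, E)) ∞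
        (fun v ↦ Bundle.TotalSpace.mk' E (E := fun x : E ↦ TangentSpace 𝓘(ℝ, E) x) v w) v :=
      contMDiffAt_vectorSpace_iff_contDiffAt.2 contDiffAt_const
    have h3 := (h.contMDiffAt ((φ.open_target.preimage
      (FiberBundle.continuous_proj E _)).mem_nhds hv)).comp v hc
    refine h3.congr_of_eventuallyEq ?_
    filter_upwards [φ.open_target.mem_nhds hv] with z hz
    simp [tangentMapWithin, mfderivWithin_of_isOpen φ.open_target hz]
  have h3 := h1.clm_bundle_apply h2
  rw [Bundle.contMDiffAt_totalSpace] at h3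
  exact h3.2.contDiffAt

theorem OneForm.inChart_ofFunction (hφ : φ ∈ IsManifold.maximalAtlas 𝓘(ℝ, E) ∞ M)
    (f : C^∞⟮𝓘(ℝ, E), M; 𝓘(ℝ, V), V⟯) {v : E} (hv : v ∈ φ.target) :
    HasFDerivAt (f ∘ φ.symm) ((OneForm.ofFunction f).inChart φ v) v := by
  have h1 := ((f.contMDiff (φ.symm v)).mdifferentiableAt (by simp)).hasMFDerivAt
  have h2 := ((mdifferentiable_of_mem_maximalAtlas hφ).mdifferentiableAt_symm hv).hasMFDerivAt
  exact (h1.comp v h2).hasFDerivAt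

/-- The product of a one-form with a smooth function, as a linear map in the one-form. -/
def OneForm.mulLeft (χ : C^∞⟮𝓘(ℝ, E), M; 𝓘(ℝ, ℝ), ℝ⟯) : OneForm E M V →ₗ[ℝ] OneForm E M V where
  toFun θ := ⟨fun x ↦ χ x • θ x, χ.contMDiff.smul_section θ.contMDiff⟩
  map_add' θ η := by
    ext x : 1
    exact smul_add (χ x) (θ x) (η x)
  map_smul' a θ := by
    ext x : 1
    exact smul_comm (χ x) a (θ x)

theorem OneForm.mulLeft_apply (χ : C^∞⟮𝓘(ℝ, E), M; 𝓘(ℝ, ℝ), ℝ⟯) (θ : OneForm E M V) (x : M) :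
    OneForm.mulLeft χ θ x = χ x • θ x := rfl

end Charts

/-! ### The smooth topology on one-forms -/

section SmoothTopology

variable {E : Type*} [NormedAddCommGroup E] [NormedSpace ℝ E] [FiniteDimensional ℝ E]
  {M : Type*} [TopologicalSpace M] [ChartedSpace E M] [IsManifold 𝓘(ℝ, E) ∞ M]
  {V : Type*} [NormedAddCommGroup V] [NormedSpace ℝ V]
  {φ : OpenPartialHomeomorph M E} {S : Set E}

/-- A smooth chart `φ` together with a set `S` that is relatively compact in its target. -/
def IsChartSet (φ : OpenPartialHomeomorph M E) (S : Set E) : Prop :=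
  φ ∈ IsManifold.maximalAtlas 𝓘(ℝ, E) ∞ M ∧ ∃ C, IsCompact C ∧ S ⊆ C ∧ C ⊆ φ.target

omit [FiniteDimensional ℝ E] [IsManifold 𝓘(ℝ, E) ∞ M] in
theorem IsChartSet.subset_target (h : IsChartSet φ S) : S ⊆ φ.target := by
  obtain ⟨_, C, _, hSC, hC⟩ := h
  exact hSC.trans hC

theorem OneForm.iteratedFDeriv_inChart_add (hφ : φ ∈ IsManifold.maximalAtlas 𝓘(ℝ, E) ∞ M) (k : ℕ)
    (θ η : OneForm E M V) {v : E} (hv : v ∈ φ.target) :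
    iteratedFDeriv ℝ k ((θ + η).inChart φ) v =
      iteratedFDeriv ℝ k (θ.inChart φ) v + iteratedFDeriv ℝ k (η.inChart φ) v := by
  have h : ∀ θ : OneForm E M V, ContDiffAt ℝ k (θ.inChart φ) v := fun θ ↦
    ((θ.contDiffOn_inChart hφ).contDiffAt (φ.open_target.mem_nhds hv)).of_le
      (by exact_mod_cast le_top)
  exact iteratedFDeriv_add_apply (h θ) (h η)

theorem OneForm.iteratedFDeriv_inChart_smul (hφ : φ ∈ IsManifold.maximalAtlas 𝓘(ℝ, E) ∞ M) (k : ℕ)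
    (a : ℝ) (θ : OneForm E M V) {v : E} (hv : v ∈ φ.target) :
    iteratedFDeriv ℝ k ((a • θ).inChart φ) v = a • iteratedFDeriv ℝ k (θ.inChart φ) v := by
  have h : ContDiffAt ℝ k (θ.inChart φ) v :=
    ((θ.contDiffOn_inChart hφ).contDiffAt (φ.open_target.mem_nhds hv)).of_le
      (by exact_mod_cast le_top)
  exact iteratedFDeriv_const_smul_apply (a := a) h

theorem OneForm.iteratedFDeriv_inChart_sub (hφ : φ ∈ IsManifold.maximalAtlas 𝓘(ℝ, E) ∞ M) (k : ℕ)
    (θ η : OneForm E M V) {v : E} (hv : v ∈ φ.target) :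
    iteratedFDeriv ℝ k ((θ - η).inChart φ) v =
      iteratedFDeriv ℝ k (θ.inChart φ) v - iteratedFDeriv ℝ k (η.inChart φ) v := by
  rw [eq_sub_iff_add_eq, ← iteratedFDeriv_inChart_add hφ k _ _ hv, sub_add_cancel]

theorem OneForm.bddAbove_iteratedFDeriv (h : IsChartSet φ S) (k : ℕ) (θ : OneForm E M V) :
    BddAbove (range fun v : S ↦ ‖iteratedFDeriv ℝ k (θ.inChart φ) v‖) := by
  obtain ⟨hφ, C, hC, hSC, hCt⟩ := h
  obtain ⟨B, hB⟩ := hC.exists_bound_of_continuousOn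
    ((continuousOn_iteratedFDeriv_of_contDiffOn φ.open_target (θ.contDiffOn_inChart hφ) k).mono hCt)
  exact ⟨B, by rintro _ ⟨v, rfl⟩; exact hB v (hSC v.2)⟩

/-- The supremum over `S` of the norm of the `k`-th derivative of a one-form in the chart `φ`. -/
def OneForm.chartSeminorm (h : IsChartSet φ S) (k : ℕ) : Seminorm ℝ (OneForm E M V) :=
  Seminorm.of (fun θ ↦ ⨆ v : S, ‖iteratedFDeriv ℝ k (θ.inChart φ) v‖)
    (fun θ η ↦ by
      refine Real.iSup_le (fun v ↦ ?_) (add_nonneg (Real.iSup_nonneg fun _ ↦ norm_nonneg _)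
        (Real.iSup_nonneg fun _ ↦ norm_nonneg _))
      rw [iteratedFDeriv_inChart_add h.1 k θ η (h.subset_target v.2)]
      exact (norm_add_le _ _).trans (add_le_add
        (le_ciSup (bddAbove_iteratedFDeriv h k θ) v) (le_ciSup (bddAbove_iteratedFDeriv h k η) v)))
    (fun a θ ↦ by
      rw [Real.mul_iSup_of_nonneg (norm_nonneg a)]
      refine iSup_congr fun v ↦ ?_
      rw [iteratedFDeriv_inChart_smul h.1 k a θ (h.subset_target v.2), norm_smul])

theorem OneForm.norm_iteratedFDeriv_le_chartSeminorm (h : IsChartSet φ S) (k : ℕ)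
    (θ : OneForm E M V) {v : E} (hv : v ∈ S) :
    ‖iteratedFDeriv ℝ k (θ.inChart φ) v‖ ≤ chartSeminorm h k θ :=
  le_ciSup (bddAbove_iteratedFDeriv h k θ) ⟨v, hv⟩

theorem OneForm.chartSeminorm_le (h : IsChartSet φ S) {k : ℕ} {θ : OneForm E M V} {B : ℝ}
    (hB0 : 0 ≤ B) (hB : ∀ v ∈ S, ‖iteratedFDeriv ℝ k (θ.inChart φ) v‖ ≤ B) :
    chartSeminorm h k θ ≤ B :=
  Real.iSup_le (fun v ↦ hB v v.2) hB0

theorem OneForm.norm_iteratedFDeriv_sub_le (h : IsChartSet φ S) (k : ℕ) (θ η : OneForm E M V)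
    {v : E} (hv : v ∈ S) :
    ‖iteratedFDeriv ℝ k (θ.inChart φ) v - iteratedFDeriv ℝ k (η.inChart φ) v‖ ≤
      chartSeminorm h k (θ - η) := by
  rw [← iteratedFDeriv_inChart_sub h.1 k _ _ (h.subset_target hv)]
  exact norm_iteratedFDeriv_le_chartSeminorm h k _ hv

theorem OneForm.norm_apply_le_chartSeminorm (h : IsChartSet φ S) {x : M} (hx : x ∈ φ.source)
    (hxS : φ x ∈ S) (θ : OneForm E M V) (w : TangentSpace 𝓘(ℝ, E) x) :
    ‖(θ x w : V)‖ ≤ @norm E _ (mfderiv 𝓘(ℝ, E) 𝓘(ℝ, E) φ x w) * chartSeminorm h 0 θ := by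
  have h1 : (θ x w : V) = θ.inChart φ (φ x) (mfderiv 𝓘(ℝ, E) 𝓘(ℝ, E) φ x w) :=
    (congrArg (fun L ↦ L w) (θ.inChart_apply_mfderiv h.1 hx)).symm
  rw [h1, mul_comm]
  refine ((θ.inChart φ (φ x)).le_opNorm _).trans ?_
  refine mul_le_mul_of_nonneg_right ?_ (norm_nonneg _)
  have h2 := norm_iteratedFDeriv_le_chartSeminorm h 0 θ hxS
  rwa [norm_iteratedFDeriv_zero] at h2

variable (E M V) in
/-- The seminorms defining the smooth topology, indexed by a chart, a compact subset of its target,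
and the order of the derivatives. -/
def OneForm.seminormFamily :
    SeminormFamily ℝ (OneForm E M V)
      ({p : OpenPartialHomeomorph M E × Set E // IsChartSet p.1 p.2} × ℕ) :=
  fun i ↦ chartSeminorm i.1.2 i.2

theorem OneForm.le_nhds_smoothTopology_iff {l : Filter (OneForm E M V)} {θ : OneForm E M V} :
    l ≤ @nhds _ (OneForm.smoothTopology E M V) θ ↔
      ∀ i, ∀ ε > 0, ∀ᶠ η in l, seminormFamily E M V i (η - θ) < ε := by
  simp only [nhds_iInf, nhds_induced, le_iInf_iff, ← Filter.map_le_iff_le_comap]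
  constructor
  · rintro h ⟨⟨⟨φ, S⟩, hφ, C, hC, hSC, hCt⟩, k⟩ ε hε
    have h1 := UniformOnFun.tendsto_iff_tendstoUniformlyOn.1 (h φ hφ k) C ⟨hC, hCt⟩
    rw [Metric.tendstoUniformlyOn_iff] at h1
    filter_upwards [h1 (ε / 2) (half_pos hε)] with η hη
    refine lt_of_le_of_lt ?_ (half_lt_self hε)
    refine chartSeminorm_le _ (half_pos hε).le fun v hv ↦ ?_
    rw [iteratedFDeriv_inChart_sub hφ k _ _ (hCt (hSC hv)), ← dist_eq_norm, dist_comm]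
    exact (hη v (hSC hv)).le
  · intro h φ hφ k
    refine UniformOnFun.tendsto_iff_tendstoUniformlyOn.2 fun C hC ↦ ?_
    rw [Metric.tendstoUniformlyOn_iff]
    intro ε hε
    have hS : IsChartSet φ C := ⟨hφ, C, hC.1, subset_rfl, hC.2⟩
    filter_upwards [h ⟨⟨(φ, C), hS⟩, k⟩ ε hε] with η hη v hv
    refine lt_of_le_of_lt ?_ hη
    rw [dist_comm, dist_eq_norm]
    exact norm_iteratedFDeriv_sub_le hS k η θ hv

variable (E M V) in
theorem OneForm.withSeminorms_smoothTopology :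
    @WithSeminorms _ _ _ _ _ _ (OneForm.seminormFamily E M V) (OneForm.smoothTopology E M V) := by
  refine @WithSeminorms.mk _ _ _ _ _ _ _ (_) (TopologicalSpace.ext_nhds fun θ ↦ ?_)
  have h : ∀ l : Filter (OneForm E M V),
      l ≤ @nhds _ ((OneForm.seminormFamily E M V).moduleFilterBasis.topology) θ ↔
      ∀ i, ∀ ε > 0, ∀ᶠ η in l, OneForm.seminormFamily E M V i (η - θ) < ε := fun l ↦ by
    let _ := (OneForm.seminormFamily E M V).moduleFilterBasis.topology
    have hw : WithSeminorms (OneForm.seminormFamily E M V) := ⟨rfl⟩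
    exact hw.tendsto_nhds id θ
  exact le_antisymm ((h _).2 (OneForm.le_nhds_smoothTopology_iff.1 le_rfl))
    (OneForm.le_nhds_smoothTopology_iff.2 ((h _).1 le_rfl))

attribute [local instance] OneForm.smoothTopology

instance : IsTopologicalAddGroup (OneForm E M V) :=
  (OneForm.withSeminorms_smoothTopology E M V).topologicalAddGroup

instance : ContinuousSMul ℝ (OneForm E M V) :=
  (OneForm.withSeminorms_smoothTopology E M V).continuousSMul

instance : LocallyConvexSpace ℝ (OneForm E M V) :=
  (OneForm.withSeminorms_smoothTopology E M V).toLocallyConvexSpace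

theorem OneForm.continuous_chartSeminorm (h : IsChartSet φ S) (k : ℕ) :
    Continuous (OneForm.chartSeminorm h k : Seminorm ℝ (OneForm E M V)) :=
  (OneForm.withSeminorms_smoothTopology E M V).continuous_seminorm ⟨⟨(φ, S), h⟩, k⟩

theorem continuous_of_norm_le_seminorm {X F : Type*} [AddCommGroup X] [Module ℝ X]
    [TopologicalSpace X] [IsTopologicalAddGroup X] [SeminormedAddCommGroup F] [NormedSpace ℝ F]
    {p : Seminorm ℝ X} (hp : Continuous p) (f : X →ₗ[ℝ] F) (h : ∀ x, ‖f x‖ ≤ p x) :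
    Continuous f := by
  refine continuous_of_continuousAt_zero f ?_
  rw [ContinuousAt, map_zero]
  refine squeeze_zero_norm h ?_
  have := hp.tendsto 0
  rwa [map_zero] at this

/-- The value of a one-form at a point of the target of a chart, read in this chart. -/
def OneForm.evalChart (hφ : φ ∈ IsManifold.maximalAtlas 𝓘(ℝ, E) ∞ M) {v : E} (hv : v ∈ φ.target) :
    OneForm E M V →L[ℝ] E →L[ℝ] V where
  toFun θ := θ.inChart φ v
  map_add' _ _ := rfl
  map_smul' _ _ := rfl
  cont := by
    have h : IsChartSet φ {v} := ⟨hφ, {v}, isCompact_singleton, subset_rfl, by simpa using hv⟩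
    refine continuous_of_norm_le_seminorm (OneForm.continuous_chartSeminorm h 0)
      ⟨⟨fun θ ↦ θ.inChart φ v, fun _ _ ↦ rfl⟩, fun _ _ ↦ rfl⟩ fun θ ↦ ?_
    have h1 := OneForm.norm_iteratedFDeriv_le_chartSeminorm h 0 θ (mem_singleton v)
    rwa [norm_iteratedFDeriv_zero] at h1

theorem OneForm.continuous_evalVec (x : M) (w : TangentSpace 𝓘(ℝ, E) x) :
    Continuous fun θ : OneForm E M V ↦ (θ x w : V) := by
  have hφ := IsManifold.chart_mem_maximalAtlas (I := 𝓘(ℝ, E)) (n := ∞) x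
  have hx := mem_chart_source E x
  have h := (evalChart (V := V) hφ ((chartAt E x).map_source hx)).continuous.clm_apply
    (continuous_const (y := (mfderiv 𝓘(ℝ, E) 𝓘(ℝ, E) (chartAt E x) x w : E)))
  refine h.congr fun θ ↦ ?_
  exact congrArg (fun L ↦ L w) (θ.inChart_apply_mfderiv hφ hx)

instance : T2Space (OneForm E M V) := by
  refine T2Space.of_injective_continuous
    (f := fun θ : OneForm E M V ↦ fun (x : M) (w : TangentSpace 𝓘(ℝ, E) x) ↦ (θ x w : V)) ?_
    (continuous_pi fun x ↦ continuous_pi fun w ↦ OneForm.continuous_evalVec x w)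
  intro θ η h
  ext x w
  exact congrFun (congrFun h x) w

section AutomaticContinuity

variable {X : Type*} [AddCommGroup X] [Module ℝ X] [TopologicalSpace X]
  [IsTopologicalAddGroup X] [ContinuousSMul ℝ X] [BarrelledSpace ℝ X]

/-- A linear map from a barrelled space to one-forms is continuous for the smooth topology as soon
as it is continuous for pointwise convergence: by Banach–Steinhaus all derivatives of the value
depend continuously on the argument, hence the seminorms, as suprema of continuous seminorms, are
lower semicontinuous, hence continuous. -/
theorem OneForm.continuous_of_continuous_apply (L : X →ₗ[ℝ] OneForm E M V)
    (hL : ∀ x (w : TangentSpace 𝓘(ℝ, E) x), Continuous fun θ ↦ (L θ x w : V)) : Continuous L := by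
  refine (withSeminorms_smoothTopology E M V).continuous_of_continuous_comp L ?_
  rintro ⟨⟨⟨φ, S⟩, hS⟩, k⟩
  have hval : ∀ y ∈ φ.target, ∃ l : X →L[ℝ] E →L[ℝ] V, ∀ θ, l θ = (L θ).inChart φ y := by
    intro y hy
    refine ⟨⟨⟨⟨fun θ ↦ (L θ).inChart φ y, fun θ η ↦ ?_⟩, fun a θ ↦ ?_⟩, ?_⟩, fun θ ↦ rfl⟩
    · rw [map_add, inChart_add]
    · change (L (a • θ)).inChart φ y = a • (L θ).inChart φ y
      rw [map_smul, inChart_smul]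
    · exact continuous_clm_apply.2 fun w ↦ hL _ _
  have hder := exists_clm_eq_iteratedFDeriv φ.open_target
    (fun θ ↦ (L θ).contDiffOn_inChart hS.1) hval k
  refine Seminorm.continuous_of_lowerSemicontinuous _ ?_
  change LowerSemicontinuous fun θ ↦ ⨆ v : S, ‖iteratedFDeriv ℝ k ((L θ).inChart φ) v‖
  refine lowerSemicontinuous_ciSup (fun θ ↦ bddAbove_iteratedFDeriv hS k (L θ)) fun v ↦ ?_
  obtain ⟨l, hl⟩ := hder v (hS.subset_target v.2)
  exact (l.continuous.norm.congr fun θ ↦ by rw [hl]).lowerSemicontinuous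

/-- A linear map with values in exact one-forms is continuous as soon as the primitives depend
continuously on the argument for pointwise convergence. -/
theorem OneForm.continuous_ofFunction_comp (L : X →ₗ[ℝ] OneForm E M V)
    (f : X → C^∞⟮𝓘(ℝ, E), M; 𝓘(ℝ, V), V⟯) (hf : ∀ θ, L θ = OneForm.ofFunction (f θ))
    (hval : ∀ y, ∃ l : X →L[ℝ] V, ∀ θ, l θ = f θ y) : Continuous L := by
  refine OneForm.continuous_of_continuous_apply L fun x w ↦ ?_
  have hφ := IsManifold.chart_mem_maximalAtlas (I := 𝓘(ℝ, E)) (n := ∞) x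
  have hx := mem_chart_source E x
  obtain ⟨l, hl⟩ := exists_clm_eq_fderiv (chartAt E x).open_target
    (G := fun θ ↦ f θ ∘ (chartAt E x).symm)
    (fun θ y hy ↦ (OneForm.inChart_ofFunction hφ (f θ) hy).differentiableAt)
    (fun y _ ↦ hval _) ((chartAt E x).map_source hx)
  have h := l.continuous.clm_apply
    (continuous_const (y := (mfderiv 𝓘(ℝ, E) 𝓘(ℝ, E) (chartAt E x) x w : E)))
  refine h.congr fun θ ↦ ?_
  rw [hl, (OneForm.inChart_ofFunction hφ (f θ) ((chartAt E x).map_source hx)).fderiv, hf]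
  exact congrArg (fun L ↦ L w) ((OneForm.ofFunction (f θ)).inChart_apply_mfderiv hφ hx)

end AutomaticContinuity

section Limit

variable [CompleteSpace V] {ι : Type*} {ψ : ι → OpenPartialHomeomorph M E} {B : ι → Set E}

theorem OneForm.exists_limit_of_cauchy (h : ∀ i, IsChartSet (ψ i) (B i)) (hB : ∀ i, IsOpen (B i))
    (hcov : ∀ x, ∃ i, x ∈ (ψ i).source ∧ ψ i x ∈ B i) (u : ℕ → OneForm E M V)
    (hu : ∀ i k, ∀ ε > 0, ∃ N, ∀ m ≥ N, ∀ n ≥ N, chartSeminorm (h i) k (u m - u n) < ε) :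
    ∃ θ, ∀ i k, ∀ ε > 0, ∃ N, ∀ n ≥ N, chartSeminorm (h i) k (u n - θ) < ε := by
  have hloc : ∀ i, ∃ g : E → E →L[ℝ] V, ContDiffOn ℝ ∞ g (B i) ∧
      ∀ k : ℕ, TendstoUniformlyOn (fun n ↦ iteratedFDeriv ℝ k ((u n).inChart (ψ i)))
        (iteratedFDeriv ℝ k g) atTop (B i) := by
    intro i
    refine exists_contDiffOn_tendstoUniformlyOn (hB i)
      (fun n ↦ ((u n).contDiffOn_inChart (h i).1).mono (h i).subset_target) fun k ↦ ?_
    rw [Metric.uniformCauchySeqOn_iff]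
    intro ε hε
    obtain ⟨N, hN⟩ := hu i k ε hε
    refine ⟨N, fun m hm n hn v hv ↦ ?_⟩
    rw [dist_eq_norm]
    exact (norm_iteratedFDeriv_sub_le (h i) k (u m) (u n) hv).trans_lt (hN m hm n hn)
  choose g hg hgu using hloc
  have hlim : ∀ i x, x ∈ (ψ i).source → ψ i x ∈ B i → ∀ w : TangentSpace 𝓘(ℝ, E) x,
      Tendsto (fun n ↦ (u n x w : V)) atTop
        (𝓝 (g i (ψ i x) (mfderiv 𝓘(ℝ, E) 𝓘(ℝ, E) (ψ i) x w))) := by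
    intro i x hx hxB w
    have h1 := (continuousMultilinearCurryFin0 ℝ E (E →L[ℝ] V)).continuous.continuousAt.tendsto.comp
      ((hgu i 0).tendsto_at hxB)
    have h2 : Tendsto (fun n ↦ (u n).inChart (ψ i) (ψ i x)) atTop (𝓝 (g i (ψ i x))) := by
      refine (h1.congr fun n ↦ ?_).trans_eq ?_ <;> simp
    let w' : E := mfderiv 𝓘(ℝ, E) 𝓘(ℝ, E) (ψ i) x w
    have h3 := ((ContinuousLinearMap.apply ℝ V w').continuous.tendsto _).comp h2
    refine h3.congr fun n ↦ ?_
    exact congrArg (fun L ↦ L w) ((u n).inChart_apply_mfderiv (h i).1 hx)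
  choose a ha haB using hcov
  let θ₀ : ∀ x : M, TangentSpace 𝓘(ℝ, E) x →L[ℝ] Bundle.Trivial M V x := fun x ↦
    (g (a x) (ψ (a x) x)).comp (mfderiv 𝓘(ℝ, E) 𝓘(ℝ, E) (ψ (a x)) x)
  have hθ₀ : ∀ i x, x ∈ (ψ i).source → ψ i x ∈ B i →
      θ₀ x = (g i (ψ i x)).comp (mfderiv 𝓘(ℝ, E) 𝓘(ℝ, E) (ψ i) x) := by
    intro i x hx hxB
    ext w
    exact tendsto_nhds_unique (hlim _ x (ha x) (haB x) w) (hlim i x hx hxB w)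
  have hopen : ∀ i x, x ∈ (ψ i).source → ψ i x ∈ B i →
      ∀ᶠ y in 𝓝 x, y ∈ (ψ i).source ∧ ψ i y ∈ B i := fun i x hx hxB ↦
    ((ψ i).open_source.eventually_mem hx).and
      (((ψ i).continuousAt hx).eventually ((hB i).eventually_mem hxB))
  let θ : OneForm E M V := ⟨θ₀, fun x ↦ by
    refine contMDiffAt_of_eventually_eq_comp_mfderiv (h (a x)).1 (ha x)
      (g := fun y ↦ g (a x) (ψ (a x) y)) ?_ ?_
    · exact ((hg _).contDiffAt ((hB _).mem_nhds (haB x))).contMDiffAt.comp x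
        (contMDiffAt_of_mem_maximalAtlas (h (a x)).1 (ha x))
    · filter_upwards [hopen _ x (ha x) (haB x)] with y hy
      exact hθ₀ _ y hy.1 hy.2⟩
  have hchart : ∀ i, ∀ v ∈ B i, θ.inChart (ψ i) v = g i v := by
    intro i v hv
    have hvt := (h i).subset_target hv
    have h1 := (mdifferentiable_of_mem_maximalAtlas (h i).1).comp_symm_deriv hvt
    have h2 := hθ₀ i ((ψ i).symm v) ((ψ i).map_target hvt) (by rwa [(ψ i).right_inv hvt])
    ext w
    have h3 : θ.inChart (ψ i) v w = g i (ψ i ((ψ i).symm v))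
        (mfderiv 𝓘(ℝ, E) 𝓘(ℝ, E) (ψ i) ((ψ i).symm v)
          (mfderiv 𝓘(ℝ, E) 𝓘(ℝ, E) (ψ i).symm v w)) := by
      change θ₀ ((ψ i).symm v) _ = _
      rw [h2]
      rfl
    have h4 : mfderiv 𝓘(ℝ, E) 𝓘(ℝ, E) (ψ i) ((ψ i).symm v)
          (mfderiv 𝓘(ℝ, E) 𝓘(ℝ, E) (ψ i).symm v w) = w := congrArg (fun L ↦ L w) h1
    rw [h3, h4, (ψ i).right_inv hvt]
  refine ⟨θ, fun i k ε hε ↦ ?_⟩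
  have h1 := hgu i k
  rw [Metric.tendstoUniformlyOn_iff] at h1
  obtain ⟨N, hN⟩ := eventually_atTop.1 (h1 (ε / 2) (half_pos hε))
  refine ⟨N, fun n hn ↦ lt_of_le_of_lt ?_ (half_lt_self hε)⟩
  refine chartSeminorm_le _ (half_pos hε).le fun v hv ↦ ?_
  rw [iteratedFDeriv_inChart_sub (h i).1 k _ _ ((h i).subset_target hv)]
  have h2 : θ.inChart (ψ i) =ᶠ[𝓝 v] g i := by
    filter_upwards [(hB i).mem_nhds hv] with z hz using hchart i z hz
  rw [(h2.iteratedFDeriv ℝ k).eq_of_nhds, ← dist_eq_norm, dist_comm]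
  exact (hN n hn v hv).le

end Limit

/-- One-forms with the smooth topology are a Fréchet space. The countably many seminorms of a
countable atlas already define a complete topology; it is barrelled, so that it agrees with the
smooth topology by automatic continuity of the identity map. -/
theorem OneForm.completeSpace_smoothTopology [CompleteSpace V] [SigmaCompactSpace M] :
    @CompleteSpace (OneForm E M V) (IsTopologicalAddGroup.rightUniformSpace (OneForm E M V)) ∧
      IsCompletelyPseudoMetrizableSpace (OneForm E M V) := by
  have hr : ∀ x : M, ∃ r > 0, Metric.closedBall (chartAt E x x) r ⊆ (chartAt E x).target :=
    fun x ↦ Metric.nhds_basis_closedBall.mem_iff.1 (chart_target_mem_nhds E x)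
  choose r hr0 hr using hr
  obtain ⟨s, hs, hcov⟩ := countable_cover_nhds_of_sigmaCompact
    (f := fun x : M ↦ (chartAt E x).source ∩
      chartAt E x ⁻¹' Metric.ball (chartAt E x x) (r x))
    fun x ↦ ((chartAt E x).isOpen_inter_preimage Metric.isOpen_ball).mem_nhds
      ⟨mem_chart_source E x, Metric.mem_ball_self (hr0 x)⟩
  have hset : ∀ x : s, IsChartSet (chartAt E (x : M)) (Metric.ball (chartAt E x.1 x) (r x)) :=
    fun x ↦ ⟨IsManifold.chart_mem_maximalAtlas x.1, _, isCompact_closedBall _ _,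
      Metric.ball_subset_closedBall, hr x⟩
  have : Countable s := hs.to_subtype
  let q : SeminormFamily ℝ (OneForm E M V) (s × ℕ) := fun i ↦ chartSeminorm (hset i.1) i.2
  have hcov' : ∀ x, ∃ i : s, x ∈ (chartAt E i.1).source ∧
      chartAt E i.1 x ∈ Metric.ball (chartAt E i.1 i) (r i) := by
    intro x
    obtain ⟨i, hi, hx⟩ := mem_iUnion₂.1 (hcov.ge (mem_univ x))
    exact ⟨⟨i, hi⟩, hx⟩
  have hseq : ∀ u : ℕ → OneForm E M V,
      (∀ i, ∀ ε > 0, ∃ N, ∀ m ≥ N, ∀ n ≥ N, q i (u m - u n) < ε) →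
      ∃ x, ∀ i, ∀ ε > 0, ∃ N, ∀ n ≥ N, q i (u n - x) < ε := by
    intro u hu
    obtain ⟨θ, hθ⟩ := exists_limit_of_cauchy hset (fun _ ↦ Metric.isOpen_ball) hcov' u
      fun i k ↦ hu (i, k)
    exact ⟨θ, fun i ↦ hθ i.1 i.2⟩
  have hq : WithSeminorms q := by
    refine withSeminorms_of_barrelled_le (fun i ↦ continuous_chartSeminorm _ _) hseq
      fun t h1 h2 h3 hqt ↦ continuous_id_iff_le.1 ?_
    refine @OneForm.continuous_of_continuous_apply E _ _ _ M _ _ _ V _ _ (OneForm E M V) _ _ t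
      h1 h2 h3 LinearMap.id fun x w ↦ ?_
    obtain ⟨i, hx, hxi⟩ := hcov' x
    let l : OneForm E M V →ₗ[ℝ] V := ⟨⟨fun θ ↦ θ x w, fun _ _ ↦ rfl⟩, fun _ _ ↦ rfl⟩
    refine @continuous_of_norm_le_seminorm (OneForm E M V) V _ _ t h1 _ _
      (@nnnorm E _ (mfderiv 𝓘(ℝ, E) 𝓘(ℝ, E) (chartAt E i.1) x w) • q (i, 0))
      ((hqt (i, 0)).const_smul (_ : NNReal)) l fun θ ↦ ?_
    exact norm_apply_le_chartSeminorm (hset i) hx hxi θ w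
  exact completeSpace_of_countable_withSeminorms hq hseq

end SmoothTopology

/-! ### Completeness of the space of compactly supported one-forms -/

section CompactSupport

attribute [local instance] OneForm.smoothTopology

variable {E : Type*} [NormedAddCommGroup E] [NormedSpace ℝ E]
  {M : Type*} [TopologicalSpace M] [ChartedSpace E M] [IsManifold 𝓘(ℝ, E) ∞ M]
  {V : Type*} [NormedAddCommGroup V] [NormedSpace ℝ V]

theorem OneForm.apply_eq_zero_of_notMem {K : Set M} {θ : OneForm E M V} (hθ : θ.support ⊆ K)
    {x : M} (hx : x ∉ K) : θ x = 0 := by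
  by_contra h
  exact hx (hθ (subset_closure h))

theorem OneForm.support_subset_of_forall {K : Set M} (hK : IsClosed K) {θ : OneForm E M V}
    (h : ∀ x ∉ K, θ x = 0) : θ.support ⊆ K :=
  closure_minimal (fun x hx ↦ by_contra fun hxK ↦ hx (h x hxK)) hK

theorem CompactOneForm.continuous_ofSupportedIn {K : Set M} (hK : IsCompact K) :
    Continuous (CompactOneForm.ofSupportedIn E V hK) :=
  continuous_sInf_rng.2 fun _ ht ↦ ht.1 K hK

set_option synthInstance.maxHeartbeats 200000 in
/-- The universal property of the inductive limit topology. -/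
theorem CompactOneForm.continuous_of_restrict {Y : Type*} [AddCommGroup Y] [Module ℝ Y]
    [TopologicalSpace Y] [IsTopologicalAddGroup Y] [ContinuousSMul ℝ Y] [LocallyConvexSpace ℝ Y]
    (L : CompactOneForm E M V →ₗ[ℝ] Y)
    (h : ∀ (K : Set M) (hK : IsCompact K),
      Continuous fun θ ↦ L (CompactOneForm.ofSupportedIn E V hK θ)) : Continuous L := by
  refine continuous_iff_le_induced.2 (sInf_le ⟨fun K hK ↦ continuous_induced_rng.2 (h K hK), ?_⟩)
  exact ⟨topologicalAddGroup_induced L, continuousSMul_induced L, LocallyConvexSpace.induced L⟩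

variable [FiniteDimensional ℝ E]

theorem CompactOneForm.continuous_seminorm_of_restrict (q : Seminorm ℝ (CompactOneForm E M V))
    (h : ∀ (K : Set M) (hK : IsCompact K),
      Continuous fun θ ↦ q (CompactOneForm.ofSupportedIn E V hK θ)) : Continuous q := by
  let p : SeminormFamily ℝ (CompactOneForm E M V) Unit := fun _ ↦ q
  let t := p.moduleFilterBasis.topology
  have hw : @WithSeminorms _ _ _ _ _ _ p t := @WithSeminorms.mk _ _ _ _ _ _ _ (_) rfl
  have hle : CompactOneForm.topologicalSpace E M V ≤ t := by
    have h1 : @IsTopologicalAddGroup _ t _ ∧ @ContinuousSMul ℝ _ _ _ t ∧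
        @LocallyConvexSpace ℝ _ _ _ _ _ t := by
      let _ := t
      exact ⟨hw.topologicalAddGroup, hw.continuousSMul, hw.toLocallyConvexSpace⟩
    refine sInf_le ⟨fun K hK ↦ ?_, h1⟩
    exact @WithSeminorms.continuous_of_continuous_comp ℝ ℝ _ _ Unit _ _ _
      _ _ _ (RingHom.id ℝ) _ p _ _ t hw
      ⟨⟨CompactOneForm.ofSupportedIn E V hK, fun _ _ ↦ rfl⟩, fun _ _ ↦ rfl⟩ fun _ ↦ h K hK
  exact continuous_le_dom hle (by
    let _ := t
    exact hw.continuous_seminorm ())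

variable (E M V) in
/-- The inclusion `Ω¹_c(M, V) → Ω¹(M, V)`. -/
def CompactOneForm.inclusion : CompactOneForm E M V →L[ℝ] OneForm E M V where
  toLinearMap := (CompactOneForm E M V).subtype
  cont := CompactOneForm.continuous_of_restrict _ fun _ _ ↦ continuous_subtype_val

instance : T2Space (CompactOneForm E M V) :=
  T2Space.of_injective_continuous Subtype.val_injective (CompactOneForm.inclusion E M V).continuous

variable [CompleteSpace V] [SigmaCompactSpace M]

instance : IsCompletelyPseudoMetrizableSpace (OneForm E M V) :=
  OneForm.completeSpace_smoothTopology.2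

theorem OneForm.continuous_mulLeft (χ : C^∞⟮𝓘(ℝ, E), M; 𝓘(ℝ, ℝ), ℝ⟯) :
    Continuous (OneForm.mulLeft χ : OneForm E M V →ₗ[ℝ] OneForm E M V) :=
  OneForm.continuous_of_continuous_apply _ fun x w ↦
    (OneForm.continuous_evalVec x w).const_smul (χ x)

variable {χ : C^∞⟮𝓘(ℝ, E), M; 𝓘(ℝ, ℝ), ℝ⟯}

variable (V) in
/-- The product with a compactly supported smooth function, as a map to compactly supported
one-forms. -/
def CompactOneForm.mulLeft (hχ : HasCompactSupport χ) :
    OneForm E M V →L[ℝ] CompactOneForm E M V where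
  toFun θ := CompactOneForm.ofSupportedIn E V hχ ⟨OneForm.mulLeft χ θ,
    OneForm.support_subset_of_forall (isClosed_tsupport _) fun x hx ↦ by
      rw [OneForm.mulLeft_apply, image_eq_zero_of_notMem_tsupport hx, zero_smul]⟩
  map_add' _ _ := Subtype.ext (map_add _ _ _)
  map_smul' _ _ := Subtype.ext (map_smul _ _ _)
  cont := (CompactOneForm.continuous_ofSupportedIn hχ).comp
    ((OneForm.continuous_mulLeft χ).subtype_mk _)

theorem CompactOneForm.mulLeft_apply (hχ : HasCompactSupport χ) (θ : OneForm E M V) (x : M) :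
    (CompactOneForm.mulLeft V hχ θ).1 x = χ x • θ x := rfl

variable {ι : Type*} (ρ : SmoothPartitionOfUnity ι 𝓘(ℝ, E) M univ)

omit [FiniteDimensional ℝ E] [IsManifold 𝓘(ℝ, E) ∞ M] [SigmaCompactSpace M] in
theorem finite_support_inter {K : Set M} (hK : IsCompact K) :
    {i | (support (ρ i) ∩ K).Nonempty}.Finite :=
  ρ.locallyFinite.finite_nonempty_inter_compact hK

theorem CompactOneForm.mulLeft_eq_zero (hχ : HasCompactSupport χ) {θ : OneForm E M V} {K : Set M}
    (hθ : θ.support ⊆ K) (h : ¬ (support χ ∩ K).Nonempty) : mulLeft V hχ θ = 0 := by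
  refine Subtype.ext ?_
  ext x : 1
  rw [mulLeft_apply]
  by_cases hx : x ∈ K
  · have : χ x = 0 := by
      by_contra hc
      exact h ⟨x, hc, hx⟩
    rw [this, zero_smul]
    rfl
  · rw [OneForm.apply_eq_zero_of_notMem hθ hx, smul_zero]
    rfl

theorem CompactOneForm.finsum_mulLeft (hρ : ∀ i, HasCompactSupport (ρ i))
    (θ : CompactOneForm E M V) : ∑ᶠ i, mulLeft V (hρ i) θ.1 = θ := by
  have hfin := finite_support_inter ρ θ.2
  have h1 : (support fun i ↦ mulLeft V (hρ i) θ.1) ⊆ hfin.toFinset := by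
    intro i hi
    rw [Finite.coe_toFinset]
    by_contra hc
    exact hi (mulLeft_eq_zero (hρ i) subset_rfl hc)
  rw [finsum_eq_sum_of_support_subset _ h1]
  refine Subtype.ext ?_
  ext x : 1
  have h2 : (∑ i ∈ hfin.toFinset, mulLeft V (hρ i) θ.1).1 x
      = ∑ i ∈ hfin.toFinset, ρ i x • θ.1 x := by
    let ev : CompactOneForm E M V →+ (TangentSpace 𝓘(ℝ, E) x →L[ℝ] Bundle.Trivial M V x) :=
      ⟨⟨fun θ ↦ θ.1 x, rfl⟩, fun _ _ ↦ rfl⟩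
    exact map_sum ev _ _
  rw [h2, ← Finset.sum_smul]
  by_cases hx : θ.1 x = 0
  · rw [hx, smul_zero]
  · have h3 : (support fun i ↦ ρ i x) ⊆ hfin.toFinset := by
      intro i hi
      rw [Finite.coe_toFinset]
      exact ⟨x, hi, subset_closure hx⟩
    rw [← finsum_eq_sum_of_support_subset _ h3, ρ.sum_eq_one (mem_univ x), one_smul]

/-- An infinite sum of seminorms carried by the members of the partition of unity is continuous for
the inductive limit topology, because on the forms supported in a compact set it is finite. -/
theorem CompactOneForm.exists_continuous_seminorm (hρ : ∀ i, HasCompactSupport (ρ i))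
    (r : ι → Seminorm ℝ (OneForm E M V)) (hr : ∀ i, Continuous (r i))
    (hr0 : ∀ i θ, mulLeft V (hρ i) θ = 0 → r i θ = 0) :
    ∃ q : Seminorm ℝ (CompactOneForm E M V), Continuous q ∧
      ∀ θ, ∀ s : Finset ι, ∑ i ∈ s, r i θ.1 ≤ q θ := by
  have hsub : ∀ {K : Set M} (hK : IsCompact K) (θ : OneForm E M V), θ.support ⊆ K →
      (support fun i ↦ r i θ) ⊆ (finite_support_inter ρ hK).toFinset := by
    intro K hK θ hθ i hi
    rw [Finite.coe_toFinset]
    by_contra hc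
    exact hi (hr0 i θ (mulLeft_eq_zero (hρ i) hθ hc))
  have hfin : ∀ θ : CompactOneForm E M V, (support fun i ↦ r i θ.1).Finite := fun θ ↦
    (Finset.finite_toSet _).subset (hsub θ.2 θ.1 subset_rfl)
  let q : Seminorm ℝ (CompactOneForm E M V) := Seminorm.of (fun θ ↦ ∑ᶠ i, r i θ.1)
    (fun θ η ↦ by
      rw [← finsum_add_distrib (hfin θ) (hfin η)]
      refine finsum_le_finsum' (hfin _) (((hfin θ).union (hfin η)).subset ?_)
        fun i ↦ map_add_le_add (r i) _ _
      exact support_add _ _)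
    (fun a θ ↦ by
      rw [← smul_eq_mul, smul_finsum]
      exact finsum_congr fun i ↦ map_smul_eq_mul (r i) _ _)
  refine ⟨q, continuous_seminorm_of_restrict q fun K hK ↦ ?_, fun θ s ↦ ?_⟩
  · have h : ∀ θ : OneForm.supportedIn E V K, q (ofSupportedIn E V hK θ) =
        ∑ i ∈ (finite_support_inter ρ hK).toFinset, r i θ.1 := fun θ ↦
      finsum_eq_sum_of_support_subset _ (hsub hK θ.1 θ.2)
    simp only [h]
    exact continuous_finsetSum _ fun i _ ↦ (hr i).comp continuous_subtype_val
  · change _ ≤ ∑ᶠ i, r i θ.1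
    classical
    rw [finsum_eq_sum_of_support_subset _
      (show (support fun i ↦ r i θ.1) ⊆ ↑(s ∪ (hfin θ).toFinset) by simp)]
    exact Finset.sum_le_sum_of_subset_of_nonneg Finset.subset_union_left
      fun i _ _ ↦ apply_nonneg _ _

theorem CompactOneForm.completeSpace (hρ : ∀ i, HasCompactSupport (ρ i)) :
    @CompleteSpace (CompactOneForm E M V)
      (IsTopologicalAddGroup.rightUniformSpace (CompactOneForm E M V)) := by
  let _ : UniformSpace (CompactOneForm E M V) := IsTopologicalAddGroup.rightUniformSpace _
  have : IsUniformAddGroup (CompactOneForm E M V) := isUniformAddGroup_of_addCommGroup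
  let _ : UniformSpace (OneForm E M V) := IsTopologicalAddGroup.rightUniformSpace _
  have : IsUniformAddGroup (OneForm E M V) := isUniformAddGroup_of_addCommGroup
  have := (OneForm.completeSpace_smoothTopology (E := E) (M := M) (V := V)).1
  refine completeSpace_of_partition (inclusion E M V) (fun i ↦ mulLeft V (hρ i)) (fun θ ↦ ?_)
    (finsum_mulLeft ρ hρ) (fun θ hθ ↦ ?_) (exists_continuous_seminorm ρ hρ)
  · refine (finite_support_inter ρ θ.2).subset fun i hi ↦ ?_
    by_contra hc
    exact hi (mulLeft_eq_zero (hρ i) subset_rfl hc)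
  · have hK : IsCompact (⋃ i ∈ {i | mulLeft V (hρ i) θ ≠ 0}, tsupport (ρ i)) :=
      hθ.isCompact_biUnion fun i _ ↦ hρ i
    refine ⟨ofSupportedIn E V hK ⟨θ, OneForm.support_subset_of_forall
      (hθ.isClosed_biUnion fun i _ ↦ isClosed_tsupport _)
      fun x hx ↦ ?_⟩, rfl⟩
    by_contra hθx
    refine zero_ne_one (α := ℝ) ?_
    rw [← ρ.sum_eq_one (mem_univ x)]
    refine (finsum_eq_zero_of_forall_eq_zero fun i ↦ ?_).symm
    by_cases hi : mulLeft V (hρ i) θ = 0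
    · have h1 : ρ i x • θ x = 0 := by
        rw [← mulLeft_apply (hρ i), hi]
        rfl
      exact (smul_eq_zero.1 h1).resolve_right hθx
    · exact image_eq_zero_of_notMem_tsupport fun hxi ↦ hx (mem_biUnion hi hxi)

end CompactSupport

/-! ### Primitives on coordinate balls -/

section ChartBall

attribute [local instance] OneForm.smoothTopology

variable (E : Type*) [NormedAddCommGroup E] [NormedSpace ℝ E]
  (M : Type*) [TopologicalSpace M] [ChartedSpace E M]

/-- A coordinate ball of `M`: a ball contained in the target of a smooth chart. -/
structure ChartBall where
  /-- The chart. -/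
  chart : OpenPartialHomeomorph M E
  /-- The centre, in coordinates. -/
  center : E
  /-- The radius, in coordinates. -/
  radius : ℝ
  chart_mem : chart ∈ IsManifold.maximalAtlas 𝓘(ℝ, E) ∞ M
  radius_pos : 0 < radius
  ball_subset : Metric.ball center radius ⊆ chart.target

variable {E M}

namespace ChartBall

/-- The coordinate ball, as a subset of `M`. -/
def domain (B : ChartBall E M) : Set M :=
  B.chart.source ∩ B.chart ⁻¹' Metric.ball B.center B.radius

/-- The centre of the coordinate ball, as a point of `M`. -/
def point (B : ChartBall E M) : M := B.chart.symm B.center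

variable (B : ChartBall E M)

theorem isOpen_domain : IsOpen B.domain := B.chart.isOpen_inter_preimage Metric.isOpen_ball

theorem symm_mem_domain {v : E} (hv : v ∈ Metric.ball B.center B.radius) :
    B.chart.symm v ∈ B.domain :=
  ⟨B.chart.map_target (B.ball_subset hv), by
    rwa [mem_preimage, B.chart.right_inv (B.ball_subset hv)]⟩

theorem point_mem_domain : B.point ∈ B.domain :=
  B.symm_mem_domain (Metric.mem_ball_self B.radius_pos)

theorem isPreconnected_domain : IsPreconnected B.domain := by
  have h : B.domain = B.chart.symm '' Metric.ball B.center B.radius := by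
    refine Subset.antisymm (fun x hx ↦ ⟨_, hx.2, B.chart.left_inv hx.1⟩) ?_
    rintro _ ⟨v, hv, rfl⟩
    exact B.symm_mem_domain hv
  rw [h]
  exact (convex_ball _ _).isPreconnected.image _
    (B.chart.continuousOn_symm.mono B.ball_subset)

theorem exists_point_eq [IsManifold 𝓘(ℝ, E) ∞ M] (x : M) {W : Set M} (hW : W ∈ 𝓝 x) :
    ∃ B : ChartBall E M, B.point = x ∧ B.domain ⊆ W := by
  have h1 : (chartAt E x).symm ⁻¹' W ∈ 𝓝 (chartAt E x x) := by
    refine ((chartAt E x).symm.continuousAt (mem_chart_target E x)).preimage_mem_nhds ?_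
    rwa [(chartAt E x).left_inv (mem_chart_source E x)]
  obtain ⟨r, hr, hsub⟩ := Metric.mem_nhds_iff.1 (inter_mem (chart_target_mem_nhds E x) h1)
  refine ⟨⟨chartAt E x, chartAt E x x, r, IsManifold.chart_mem_maximalAtlas x, hr,
    hsub.trans inter_subset_left⟩, (chartAt E x).left_inv (mem_chart_source E x), fun y hy ↦ ?_⟩
  have h2 := (hsub hy.2).2
  rwa [mem_preimage, (chartAt E x).left_inv hy.1] at h2

variable [IsManifold 𝓘(ℝ, E) ∞ M] {V : Type*} [NormedAddCommGroup V] [NormedSpace ℝ V]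

/-- The integral of a one-form along the coordinate segment from the centre of a coordinate ball
to the point `x`. -/
def primitive (θ : OneForm E M V) (x : M) : V :=
  ∫ t in (0 : ℝ)..1, θ.inChart B.chart (B.center + t • (B.chart x - B.center))
    (B.chart x - B.center)

variable {B} {x : M}

theorem primitive_eq_zero (hx : x ∈ B.domain) {θ : OneForm E M V} (hθ : ∀ z ∈ B.domain, θ z = 0) :
    B.primitive θ x = 0 := by
  refine intervalIntegral.integral_zero_ae (Eventually.of_forall fun t ht ↦ ?_)
  rw [uIoc_of_le zero_le_one] at ht
  have h := hθ _ (B.symm_mem_domain (add_smul_sub_mem_ball hx.2 (Ioc_subset_Icc_self ht)))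
  change θ (B.chart.symm _) _ = 0
  rw [h]
  rfl

variable [FiniteDimensional ℝ E]

theorem continuousOn_inChart_ray (θ : OneForm E M V) (hx : x ∈ B.domain) :
    ContinuousOn (fun t : ℝ ↦ θ.inChart B.chart (B.center + t • (B.chart x - B.center)))
      (Icc 0 1) :=
  continuousOn_comp_ray ((θ.contDiffOn_inChart B.chart_mem).continuousOn.mono B.ball_subset) hx.2

theorem intervalIntegrable_inChart_ray (θ : OneForm E M V) (hx : x ∈ B.domain) :
    IntervalIntegrable (fun t : ℝ ↦ θ.inChart B.chart (B.center + t • (B.chart x - B.center)))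
      MeasureTheory.volume 0 1 :=
  ContinuousOn.intervalIntegrable_of_Icc zero_le_one (continuousOn_inChart_ray θ hx)

theorem exists_clm_eq_primitive (hx : x ∈ B.domain) :
    ∃ l : OneForm E M V →L[ℝ] V, ∀ θ, l θ = B.primitive θ x := by
  have hint : ∀ θ : OneForm E M V, IntervalIntegrable
      (fun t : ℝ ↦ θ.inChart B.chart (B.center + t • (B.chart x - B.center))
        (B.chart x - B.center)) MeasureTheory.volume 0 1 := fun θ ↦
    ContinuousOn.intervalIntegrable_of_Icc zero_le_one
      ((continuousOn_inChart_ray θ hx).clm_apply continuousOn_const)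
  let l : OneForm E M V →ₗ[ℝ] V :=
    ⟨⟨fun θ ↦ B.primitive θ x, fun θ η ↦ intervalIntegral.integral_add (hint θ) (hint η)⟩,
      fun a θ ↦ intervalIntegral.integral_smul a _⟩
  let S : Set E := (fun t : ℝ ↦ B.center + t • (B.chart x - B.center)) '' Icc 0 1
  have hS : IsChartSet B.chart S := by
    refine ⟨B.chart_mem, S, isCompact_Icc.image (by fun_prop), subset_rfl, ?_⟩
    rintro _ ⟨t, ht, rfl⟩
    exact B.ball_subset (add_smul_sub_mem_ball hx.2 ht)
  refine ⟨⟨l, continuous_of_norm_le_seminorm (p := ‖B.chart x - B.center‖₊ •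
    OneForm.chartSeminorm hS 0) ((OneForm.continuous_chartSeminorm hS 0).const_smul (_ : NNReal))
    l fun θ ↦ ?_⟩, fun _ ↦ rfl⟩
  change ‖B.primitive θ x‖ ≤ ‖B.chart x - B.center‖ * OneForm.chartSeminorm hS 0 θ
  refine (intervalIntegral.norm_integral_le_of_norm_le_const (C := ‖B.chart x - B.center‖ *
    OneForm.chartSeminorm hS 0 θ) fun t ht ↦ ?_).trans (by simp)
  rw [uIoc_of_le zero_le_one] at ht
  rw [mul_comm]
  refine (ContinuousLinearMap.le_opNorm _ _).trans
    (mul_le_mul_of_nonneg_right ?_ (norm_nonneg _))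
  have h := OneForm.norm_iteratedFDeriv_le_chartSeminorm hS 0 θ
    (mem_image_of_mem _ (Ioc_subset_Icc_self ht))
  rwa [norm_iteratedFDeriv_zero] at h

theorem primitive_ofFunction [CompleteSpace V] (hx : x ∈ B.domain)
    (f : C^∞⟮𝓘(ℝ, E), M; 𝓘(ℝ, V), V⟯) :
    B.primitive (OneForm.ofFunction f) x = f x - f B.point := by
  have hd : ∀ t ∈ Icc (0 : ℝ) 1, HasDerivAt
      (fun t : ℝ ↦ (f ∘ B.chart.symm) (B.center + t • (B.chart x - B.center)))
      ((OneForm.ofFunction f).inChart B.chart (B.center + t • (B.chart x - B.center))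
        (B.chart x - B.center)) t := by
    intro t ht
    have h1 := OneForm.inChart_ofFunction B.chart_mem f
      (B.ball_subset (add_smul_sub_mem_ball hx.2 ht))
    have h2 : HasDerivAt (fun t : ℝ ↦ B.center + t • (B.chart x - B.center))
        (B.chart x - B.center) t := by
      simpa using ((hasDerivAt_id t).smul_const (B.chart x - B.center)).const_add B.center
    exact h1.comp_hasDerivAt t h2
  have h := intervalIntegral.integral_eq_sub_of_hasDerivAt
    (fun t ht ↦ hd t (by rwa [uIcc_of_le zero_le_one] at ht))
    (ContinuousOn.intervalIntegrable_of_Icc zero_le_one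
      ((continuousOn_inChart_ray (OneForm.ofFunction f) hx).clm_apply continuousOn_const))
  refine h.trans ?_
  simp [B.chart.left_inv hx.1, point]

theorem contMDiffAt_primitive [CompleteSpace V] (hx : x ∈ B.domain) (θ : OneForm E M V) :
    ContMDiffAt 𝓘(ℝ, E) 𝓘(ℝ, V) ∞ (B.primitive θ) x := by
  have h1 := contDiffOn_integral_ray ((θ.contDiffOn_inChart B.chart_mem).mono B.ball_subset)
  have h2 := h1.clm_apply (contDiffOn_id.sub (contDiffOn_const (c := B.center)))
  have h3 := (h2.contDiffAt (Metric.isOpen_ball.mem_nhds hx.2)).contMDiffAt.comp x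
    (contMDiffAt_of_mem_maximalAtlas B.chart_mem hx.1)
  refine h3.congr_of_eventuallyEq ?_
  filter_upwards [B.isOpen_domain.mem_nhds hx] with y hy
  exact (ContinuousLinearMap.intervalIntegral_apply (intervalIntegrable_inChart_ray θ hy) _).symm

end ChartBall

end ChartBall

/-! ### Integrals along paths and rays -/

section Linked

attribute [local instance] OneForm.smoothTopology

variable {E : Type*} [NormedAddCommGroup E] [NormedSpace ℝ E]
  {M : Type*} [TopologicalSpace M] [ChartedSpace E M] [IsManifold 𝓘(ℝ, E) ∞ M]

variable (E) in
/-- There is a continuous functional on one-forms which sends every exact form to the difference of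
the values of the primitive at `y` and at `x`, and which only depends on the restriction of the
form to `W`. (An integral along a path in `W` from `x` to `y` is such a functional.) -/
def Linked (V : Type*) [NormedAddCommGroup V] [NormedSpace ℝ V] (W : Set M) (x y : M) : Prop :=
  ∃ e : OneForm E M V →L[ℝ] V, (∀ f, e (OneForm.ofFunction f) = f y - f x) ∧
    ∀ θ : OneForm E M V, (∀ z ∈ W, θ z = 0) → e θ = 0

variable {V : Type*} [NormedAddCommGroup V] [NormedSpace ℝ V] {W : Set M} {x y z : M}

theorem Linked.trans [FiniteDimensional ℝ E] (h1 : Linked E V W x y) (h2 : Linked E V W y z) :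
    Linked E V W x z := by
  obtain ⟨e, he, he0⟩ := h1
  obtain ⟨e', he', he0'⟩ := h2
  refine ⟨e + e', fun f ↦ ?_, fun θ hθ ↦ ?_⟩
  · rw [add_apply, he, he']
    abel
  · rw [add_apply, he0 θ hθ, he0' θ hθ, add_zero]

theorem Linked.symm [FiniteDimensional ℝ E] (h : Linked E V W x y) : Linked E V W y x := by
  obtain ⟨e, he, he0⟩ := h
  refine ⟨-e, fun f ↦ ?_, fun θ hθ ↦ ?_⟩
  · rw [neg_apply, he, neg_sub]
  · rw [neg_apply, he0 θ hθ, neg_zero]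

variable [FiniteDimensional ℝ E] [CompleteSpace V]

theorem linked_of_mem_chartBall (B : ChartBall E M) (hB : B.domain ⊆ W) (hx : x ∈ B.domain) :
    Linked E V W B.point x := by
  obtain ⟨l, hl⟩ := ChartBall.exists_clm_eq_primitive (V := V) hx
  refine ⟨l, fun f ↦ ?_, fun θ hθ ↦ ?_⟩
  · rw [hl, ChartBall.primitive_ofFunction hx]
  · rw [hl, ChartBall.primitive_eq_zero hx fun z hz ↦ hθ z (hB hz)]

theorem linked_of_isPreconnected {s : Set M} (hs : IsPreconnected s) (hW : IsOpen W) (hsW : s ⊆ W)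
    (hx : x ∈ s) (hy : y ∈ s) : Linked E V W x y := by
  refine hs.induction₂ (Linked E V W) (fun z hz ↦ ?_) (fun _ _ _ _ _ _ ↦ Linked.trans)
    (fun _ _ _ _ ↦ Linked.symm) hx hy
  obtain ⟨B, rfl, hB⟩ := ChartBall.exists_point_eq (E := E) z (hW.mem_nhds (hsW hz))
  filter_upwards [mem_nhdsWithin_of_mem_nhds (B.isOpen_domain.mem_nhds B.point_mem_domain)]
    with x hx
  exact linked_of_mem_chartBall B hB hx

end Linked

section Rays

attribute [local instance] OneForm.smoothTopology

variable {E : Type*} [NormedAddCommGroup E] [NormedSpace ℝ E]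
  {M : Type*} [TopologicalSpace M] [ChartedSpace E M] {K : ℕ → Set M}

theorem IsSaturatedExhaustive.monotone (hK : IsSaturatedExhaustive E K) : Monotone K :=
  monotone_nat_of_le_succ fun n ↦ (hK.subset_interior n).trans interior_subset

theorem IsSaturatedExhaustive.exists_subset (hK : IsSaturatedExhaustive E K) {C : Set M}
    (hC : IsCompact C) : ∃ n, C ⊆ K n := by
  obtain ⟨n, hn⟩ := hC.elim_directed_cover (fun n ↦ interior (K n)) (fun _ ↦ isOpen_interior)
    (fun x _ ↦ by
      obtain ⟨n, hn⟩ := mem_iUnion.1 (hK.iUnion_eq.ge (mem_univ x))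
      exact mem_iUnion.2 ⟨n + 1, hK.subset_interior n hn⟩)
    (Monotone.directed_le fun m n hmn ↦ interior_mono (hK.monotone hmn))
  exact ⟨n, hn.trans interior_subset⟩

theorem IsSaturatedExhaustive.isClosed [T2Space M] (hK : IsSaturatedExhaustive E K) (n : ℕ) :
    IsClosed (K n) :=
  (hK.isCompactDomain n).isCompact.isClosed

variable [FiniteDimensional ℝ E] [T2Space M] [IsManifold 𝓘(ℝ, E) ∞ M]
  {V : Type*} [NormedAddCommGroup V] [NormedSpace ℝ V]

/-- A functional on compactly supported one-forms that, on the forms supported in any given `K N`,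
extends to a continuous functional on all one-forms. -/
def IsExtendable (K : ℕ → Set M) (c : CompactOneForm E M V →ₗ[ℝ] V) : Prop :=
  ∀ N, ∃ e : OneForm E M V →L[ℝ] V, ∀ θ : CompactOneForm E M V, θ.1.support ⊆ K N → c θ = e θ.1

variable [CompleteSpace V]

omit [FiniteDimensional ℝ E] [IsManifold 𝓘(ℝ, E) ∞ M] [CompleteSpace V] in
theorem IsSaturatedExhaustive.exists_mem_component (hK : IsSaturatedExhaustive E K) {n : ℕ} {x : M}
    (hx : x ∉ K n) (m : ℕ) : ∃ y ∈ connectedComponentIn (K n)ᶜ x, y ∉ K m := by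
  by_contra! h
  exact hK.not_relativelyCompact n x hx ((hK.isCompactDomain m).isCompact.of_isClosed_subset
    isClosed_closure (closure_minimal h (hK.isClosed m)))

/-- The integral along a ray from `x` to infinity that stays outside `K n`. Saturation provides the
ray, piece by piece: a point outside `K m` can be joined, outside `K m`, to a point outside
`K (m + 1)`. -/
theorem IsSaturatedExhaustive.exists_ray (hK : IsSaturatedExhaustive E K) {n : ℕ} {x : M}
    (hx : x ∉ K n) : ∃ c : CompactOneForm E M V →ₗ[ℝ] V,
      (∀ f, c (differential E M V f) = f.1 x) ∧
      (∀ θ : CompactOneForm E M V, θ.1.support ⊆ K n → c θ = 0) ∧ IsExtendable K c := by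
  have hstep : ∀ m, ∀ y : {y // y ∉ K m}, ∃ z : {z // z ∉ K (m + 1)},
      Linked E V (K m)ᶜ y.1 z.1 := by
    rintro m ⟨y, hy⟩
    obtain ⟨z, hz, hzK⟩ := hK.exists_mem_component hy (m + 1)
    exact ⟨⟨z, hzK⟩, linked_of_isPreconnected isPreconnected_connectedComponentIn
      (hK.isClosed m).isOpen_compl (connectedComponentIn_subset _ _)
      (mem_connectedComponentIn hy) hz⟩
  choose s hs using hstep
  let p : ∀ m, {y // y ∉ K (n + m)} := fun m ↦
    Nat.rec (motive := fun m ↦ {y // y ∉ K (n + m)}) ⟨x, hx⟩ (fun m y ↦ s (n + m) y) m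
  have hp : ∀ m, Linked E V (K (n + m))ᶜ (p m).1 (p (m + 1)).1 := fun m ↦ hs (n + m) (p m)
  choose e he he0 using hp
  have hvan : ∀ (θ : OneForm E M V) (N m : ℕ), θ.support ⊆ K N → N ≤ n + m → e m θ = 0 :=
    fun θ N m hθ hN ↦ he0 m θ fun z hz ↦
      OneForm.apply_eq_zero_of_notMem (hθ.trans (hK.monotone hN)) hz
  have hsupp : ∀ (θ : OneForm E M V) (N : ℕ), θ.support ⊆ K N →
      (support fun m ↦ e m θ) ⊆ ↑(Finset.range (N - n)) := by
    intro θ N hθ m hm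
    rw [Finset.coe_range, mem_Iio]
    by_contra hc
    exact hm (hvan θ N m hθ (by omega))
  have hfin : ∀ θ : CompactOneForm E M V, (support fun m ↦ e m θ.1).Finite := fun θ ↦ by
    obtain ⟨N, hN⟩ := hK.exists_subset θ.2
    exact (Finset.finite_toSet _).subset (hsupp θ.1 N hN)
  let c : CompactOneForm E M V →ₗ[ℝ] V :=
    { toFun := fun θ ↦ -∑ᶠ m, e m θ.1
      map_add' := fun θ η ↦ by
        rw [← neg_add, ← finsum_add_distrib (hfin θ) (hfin η)]
        exact congrArg Neg.neg (finsum_congr fun m ↦ map_add (e m) _ _)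
      map_smul' := fun a θ ↦ by
        rw [RingHom.id_apply, smul_neg, smul_finsum]
        exact congrArg Neg.neg (finsum_congr fun m ↦ map_smul (e m) _ _) }
  have hc : ∀ (θ : CompactOneForm E M V) (N : ℕ), θ.1.support ⊆ K N →
      c θ = -∑ m ∈ Finset.range (N - n), e m θ.1 := fun θ N hθ ↦
    congrArg Neg.neg (finsum_eq_sum_of_support_subset _ (hsupp θ.1 N hθ))
  refine ⟨c, fun f ↦ ?_, fun θ hθ ↦ ?_, fun N ↦ ?_⟩
  · obtain ⟨N, hN⟩ := hK.exists_subset f.2.isCompact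
    have h1 := hc (differential E M V f) N
      ((OneForm.support_ofFunction_subset f.1).trans hN)
    have h2 : ∀ m, e m (differential E M V f).1 = f.1 (p (m + 1)).1 - f.1 (p m).1 :=
      fun m ↦ he m f.1
    have h3 : (p (N - n)).1 ∉ K N := fun h ↦ (p (N - n)).2 (hK.monotone (by omega) h)
    have h4 : f.1 (p (N - n)).1 = 0 := image_eq_zero_of_notMem_tsupport fun h ↦ h3 (hN h)
    rw [h1, Finset.sum_congr rfl fun m _ ↦ h2 m,
      Finset.sum_range_sub (fun m ↦ f.1 (p m).1) (N - n), h4, zero_sub, neg_neg]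
    rfl
  · rw [hc θ n hθ, Nat.sub_self, Finset.sum_range_zero, neg_zero]
  · refine ⟨-∑ m ∈ Finset.range (N - n), e m, fun θ hθ ↦ ?_⟩
    rw [hc θ N hθ]
    simp

/-- Every point carries a functional on compactly supported one-forms which recovers the value at
this point of the primitive of an exact form, up to a locally constant function. For a point outside
`K 0` or joined to such a point this is the integral along a ray. The components of `M` contained
in `K 0` are compact; there it is the integral along a path from a base point. -/
theorem IsSaturatedExhaustive.exists_functional (hK : IsSaturatedExhaustive E K) :
    ∃ (c : M → CompactOneForm E M V →ₗ[ℝ] V) (g : CompactFunction E M V → M → V),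
      (∀ f, IsLocallyConstant (g f)) ∧
      (∀ x f, c x (differential E M V f) = f.1 x - g f x) ∧
      (∀ x N, x ∉ K N → ∀ θ : CompactOneForm E M V, θ.1.support ⊆ K N → c x θ = 0) ∧
      ∀ x, IsExtendable K (c x) := by
  classical
  have hlc : LocallyConnectedSpace M := ChartedSpace.locallyConnectedSpace E M
  let b : M → M := fun x ↦ surjInv ConnectedComponents.surjective_coe (x : ConnectedComponents M)
  have hb : ∀ x, connectedComponent (b x) = connectedComponent x := fun x ↦
    ConnectedComponents.coe_eq_coe.1 (surjInv_eq ConnectedComponents.surjective_coe _)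
  let g : CompactFunction E M V → M → V := fun f x ↦
    if connectedComponent x ⊆ K 0 then f.1 (b x) else 0
  have hg : ∀ f, IsLocallyConstant (g f) := by
    intro f
    rw [IsLocallyConstant.iff_eventually_eq]
    intro x
    filter_upwards [isOpen_connectedComponent.mem_nhds mem_connectedComponent] with y hy
    have h1 := connectedComponent_eq hy
    have h2 : b y = b x := congrArg (surjInv ConnectedComponents.surjective_coe)
      (ConnectedComponents.coe_eq_coe.2 h1.symm)
    simp only [g, h1, h2]
  have hext : ∀ e : OneForm E M V →L[ℝ] V,
      IsExtendable K (e.toLinearMap ∘ₗ (CompactOneForm E M V).subtype) :=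
    fun e N ↦ ⟨e, fun _ _ ↦ rfl⟩
  have hc : ∀ x, ∃ c : CompactOneForm E M V →ₗ[ℝ] V,
      (∀ f, c (differential E M V f) = f.1 x - g f x) ∧
      (∀ N, x ∉ K N → ∀ θ : CompactOneForm E M V, θ.1.support ⊆ K N → c θ = 0) ∧
      IsExtendable K c := by
    intro x
    by_cases hx : connectedComponent x ⊆ K 0
    · have hxN : ∀ N, x ∈ K N := fun N ↦ hK.monotone (Nat.zero_le N) (hx mem_connectedComponent)
      obtain ⟨e, he, -⟩ := linked_of_isPreconnected (E := E) (V := V) (x := b x) (y := x)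
        isPreconnected_connectedComponent isOpen_univ (subset_univ (connectedComponent x))
        (hb x ▸ mem_connectedComponent) mem_connectedComponent
      refine ⟨_, fun f ↦ ?_, fun N h ↦ absurd (hxN N) h, hext e⟩
      rw [show g f x = f.1 (b x) from if_pos hx]
      exact he f.1
    · have hg0 : ∀ f, g f x = 0 := fun f ↦ if_neg hx
      by_cases hx0 : x ∈ K 0
      · obtain ⟨y, hy, hyK⟩ := not_subset.1 hx
        obtain ⟨c, hc, -, hcK⟩ := hK.exists_ray (V := V) hyK
        obtain ⟨e, he, -⟩ := linked_of_isPreconnected (E := E) (V := V)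
          isPreconnected_connectedComponent isOpen_univ (subset_univ _) hy mem_connectedComponent
        refine ⟨c + e.toLinearMap ∘ₗ (CompactOneForm E M V).subtype, fun f ↦ ?_,
          fun N h ↦ absurd (hK.monotone (Nat.zero_le N) hx0) h, fun N ↦ ?_⟩
        · rw [hg0, sub_zero, LinearMap.add_apply, hc]
          have h := he f.1
          change f.1 y + e (OneForm.ofFunction f.1) = f.1 x
          rw [h]
          abel
        · obtain ⟨e', he'⟩ := hcK N
          refine ⟨e' + e, fun θ hθ ↦ ?_⟩
          rw [LinearMap.add_apply, he' θ hθ]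
          rfl
      · -- The ray is chosen outside the largest `K n` that does not contain `x`.
        have hex : ∃ n, x ∈ K n := mem_iUnion.1 (hK.iUnion_eq.ge (mem_univ x))
        have hpos : Nat.find hex ≠ 0 := fun h ↦ hx0 (h ▸ Nat.find_spec hex)
        obtain ⟨c, hc, hc0, hcK⟩ := hK.exists_ray (V := V) (n := Nat.find hex - 1) (x := x)
          (Nat.find_min hex (by omega))
        refine ⟨c, fun f ↦ by rw [hc, hg0, sub_zero], fun N hN θ hθ ↦ hc0 θ (hθ.trans ?_), hcK⟩
        refine hK.monotone ?_
        by_contra hlt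
        exact hN (hK.monotone (by omega) (Nat.find_spec hex))
  choose c h1 h2 h3 using hc
  exact ⟨c, g, hg, h1, h2, h3⟩

end Rays

/-! ### Compactly supported primitives -/

section Projection

attribute [local instance] OneForm.smoothTopology

variable {E : Type*} [NormedAddCommGroup E] [NormedSpace ℝ E]
  {M : Type*} [TopologicalSpace M] [ChartedSpace E M]

theorem IsSaturatedExhaustive.exists_nhds {K : ℕ → Set M} [T2Space M]
    (hK : IsSaturatedExhaustive E K) (x : M) :
    ∃ W ∈ 𝓝 x, ∀ N, (W ∩ K N).Nonempty → W ⊆ K (N + 1) := by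
  classical
  have hex : ∃ n, x ∈ K n := mem_iUnion.1 (hK.iUnion_eq.ge (mem_univ x))
  refine ⟨interior (K (Nat.find hex + 1)) ∩ ⋂ m ∈ Finset.range (Nat.find hex), (K m)ᶜ, ?_, ?_⟩
  · refine inter_mem (isOpen_interior.mem_nhds (hK.subset_interior _ (Nat.find_spec hex)))
      ((Filter.biInter_finset_mem _).2 fun m hm ↦ ?_)
    exact (hK.isClosed m).isOpen_compl.mem_nhds (Nat.find_min hex (Finset.mem_range.1 hm))
  · rintro N ⟨y, ⟨-, hy⟩, hyN⟩
    have hN : Nat.find hex ≤ N := by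
      by_contra hlt
      exact mem_iInter₂.1 hy N (Finset.mem_range.2 (not_le.1 hlt)) hyN
    exact inter_subset_left.trans (interior_subset.trans (hK.monotone (by omega)))

variable [IsManifold 𝓘(ℝ, E) ∞ M] {V : Type*} [NormedAddCommGroup V] [NormedSpace ℝ V]

theorem differential_eq_zero {f : CompactFunction E M V} (hf : IsLocallyConstant f.1) :
    differential E M V f = 0 := by
  refine Subtype.ext ?_
  ext x : 1
  have h : (f.1 : M → V) =ᶠ[𝓝 x] fun _ ↦ f.1 x := (IsLocallyConstant.iff_eventually_eq _).1 hf x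
  change mvfderiv 𝓘(ℝ, E) f.1 x = 0
  rw [mvfderiv, h.mfderiv_eq, mfderiv_const]
  exact ContinuousLinearMap.comp_zero _

variable {ι : Type*} (ρ : SmoothPartitionOfUnity ι 𝓘(ℝ, E) M univ)
  (B : ι → ChartBall E M) (c : ι → CompactOneForm E M V →ₗ[ℝ] V)

/-- The candidate for a primitive of a compactly supported one-form `θ`: the integral of `θ` along
the radii of the coordinate ball `B i`, with value `c i θ` at the centre, is a function on `B i`,
and these local functions are glued by the partition of unity `ρ`. -/
def gluedPrimitive (θ : CompactOneForm E M V) (y : M) : V :=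
  ∑ᶠ i, ρ i y • (c i θ + (B i).primitive θ.1 y)

variable {ρ B c}

theorem tsupport_gluedPrimitive_subset [T2Space M] {K : ℕ → Set M}
    (hK : IsSaturatedExhaustive E K)
    (hρ : ρ.IsSubordinate fun i ↦ (B i).domain)
    (hB : ∀ i N, ((B i).domain ∩ K N).Nonempty → (B i).domain ⊆ K (N + 1))
    (hc : ∀ i N, (B i).point ∉ K N → ∀ θ : CompactOneForm E M V, θ.1.support ⊆ K N → c i θ = 0)
    {N : ℕ} {θ : CompactOneForm E M V} (hθ : θ.1.support ⊆ K N) :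
    tsupport (gluedPrimitive ρ B c θ) ⊆ K (N + 1) := by
  refine closure_minimal (fun y hy ↦ ?_) (hK.isClosed _)
  by_contra hyN
  refine hy (finsum_eq_zero_of_forall_eq_zero fun i ↦ ?_)
  by_cases hi : ρ i y = 0
  · rw [hi, zero_smul]
  · have hyi : y ∈ (B i).domain := hρ i (subset_tsupport _ hi)
    have hdisj : ∀ z ∈ (B i).domain, z ∉ K N := fun z hz hzN ↦ hyN (hB i N ⟨z, hz, hzN⟩ hyi)
    rw [hc i N (hdisj _ (B i).point_mem_domain) θ hθ, ChartBall.primitive_eq_zero hyi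
      fun z hz ↦ OneForm.apply_eq_zero_of_notMem hθ (hdisj z hz), add_zero, smul_zero]

variable [FiniteDimensional ℝ E]

/-- A cover by coordinate balls, each of which meets at most two consecutive layers of the
exhaustion, together with a subordinate partition of unity. -/
theorem IsSaturatedExhaustive.exists_partition [T2Space M] [SigmaCompactSpace M] {K : ℕ → Set M}
    (hK : IsSaturatedExhaustive E K) :
    ∃ (B : M → ChartBall E M) (ρ : SmoothPartitionOfUnity M 𝓘(ℝ, E) M univ),
      (ρ.IsSubordinate fun x ↦ (B x).domain) ∧
      ∀ x N, ((B x).domain ∩ K N).Nonempty → (B x).domain ⊆ K (N + 1) := by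
  choose W hW hWK using hK.exists_nhds
  choose B hBx hBW using fun x ↦ ChartBall.exists_point_eq (E := E) x (hW x)
  obtain ⟨ρ, hρ⟩ := SmoothPartitionOfUnity.exists_isSubordinate 𝓘(ℝ, E) isClosed_univ
    (fun x ↦ (B x).domain) (fun x ↦ (B x).isOpen_domain)
    fun x _ ↦ mem_iUnion.2 ⟨x, by simpa only [hBx] using (B x).point_mem_domain⟩
  exact ⟨B, ρ, hρ, fun x N hN ↦
    (hBW x).trans (hWK x N (hN.mono (inter_subset_inter_left _ (hBW x))))⟩

theorem OneForm.isClosed_supportedIn {K : Set M} (hK : IsClosed K) :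
    IsClosed (OneForm.supportedIn E V K : Set (OneForm E M V)) := by
  have h : (OneForm.supportedIn E V K : Set (OneForm E M V)) =
      ⋂ (x : M) (_ : x ∉ K) (w : TangentSpace 𝓘(ℝ, E) x),
        {θ : OneForm E M V | (θ x w : V) = 0} := by
    ext θ
    simp only [mem_iInter]
    refine ⟨fun hθ x hx w ↦ ?_, fun hθ ↦ support_subset_of_forall hK fun x hx ↦ ?_⟩
    · change θ x w = 0
      rw [apply_eq_zero_of_notMem hθ hx]
      rfl
    · ext w
      exact hθ x hx w
  rw [h]
  exact isClosed_iInter fun x ↦ isClosed_iInter fun _ ↦ isClosed_iInter fun w ↦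
    isClosed_eq (continuous_evalVec x w) continuous_const

set_option synthInstance.maxHeartbeats 200000 in
theorem OneForm.barrelledSpace_supportedIn [CompleteSpace V] [SigmaCompactSpace M] {K : Set M}
    (hK : IsClosed K) : BarrelledSpace ℝ (OneForm.supportedIn E V K) := by
  have := (isClosed_supportedIn (E := E) (V := V) hK).isClosedEmbedding_subtypeVal
    |>.IsCompletelyPseudoMetrizableSpace
  exact BaireSpace.instBarrelledSpace

set_option synthInstance.maxHeartbeats 200000 in
/-- Continuity of a map to exact forms, checked on the primitives: these have to be supported in a
common compact set and to depend continuously on `θ` for pointwise convergence, as long as the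
support of `θ` stays in a compact set. -/
theorem continuous_differential_comp [CompleteSpace V] [T2Space M] [SigmaCompactSpace M]
    (Φ : CompactOneForm E M V →ₗ[ℝ] CompactFunction E M V)
    (hΦ : ∀ C : Set M, IsCompact C →
      (∃ C', IsCompact C' ∧ ∀ θ : CompactOneForm E M V, θ.1.support ⊆ C →
        tsupport (Φ θ).1 ⊆ C') ∧
      ∀ y, ∃ l : OneForm E M V →L[ℝ] V, ∀ θ : CompactOneForm E M V, θ.1.support ⊆ C →
        l θ.1 = (Φ θ).1 y) :
    Continuous (differential E M V ∘ₗ Φ) := by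
  refine CompactOneForm.continuous_of_restrict _ fun C hC ↦ ?_
  obtain ⟨⟨C', hC', hsupp⟩, hl⟩ := hΦ C hC
  have := OneForm.barrelledSpace_supportedIn (E := E) (V := V) hC.isClosed
  let j : OneForm.supportedIn E V C →ₗ[ℝ] CompactOneForm E M V :=
    Submodule.inclusion fun θ hθ ↦ (CompactOneForm.ofSupportedIn E V hC ⟨θ, hθ⟩).2
  have hcont : Continuous ((CompactOneForm E M V).subtype ∘ₗ differential E M V ∘ₗ Φ ∘ₗ j) :=
    OneForm.continuous_ofFunction_comp _ (fun θ ↦ (Φ (j θ)).1) (fun _ ↦ rfl) fun y ↦ by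
      obtain ⟨l, hl⟩ := hl y
      exact ⟨l.comp (OneForm.supportedIn E V C).subtypeL, fun θ ↦ hl (j θ) θ.2⟩
  exact (CompactOneForm.continuous_ofSupportedIn hC').comp
    (hcont.subtype_mk fun θ ↦ (OneForm.support_ofFunction_subset _).trans (hsupp (j θ) θ.2))

theorem exists_clm_eq_gluedPrimitive {K : ℕ → Set M} (hρ : ρ.IsSubordinate fun i ↦ (B i).domain)
    (hc : ∀ i, IsExtendable K (c i)) (N : ℕ) (y : M) :
    ∃ l : OneForm E M V →L[ℝ] V, ∀ θ : CompactOneForm E M V, θ.1.support ⊆ K N →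
      l θ.1 = gluedPrimitive ρ B c θ y := by
  have hl : ∀ i, ∃ l : OneForm E M V →L[ℝ] V, ∀ θ : CompactOneForm E M V, θ.1.support ⊆ K N →
      l θ.1 = ρ i y • (c i θ + (B i).primitive θ.1 y) := by
    intro i
    by_cases hi : ρ i y = 0
    · exact ⟨0, fun θ _ ↦ by rw [hi, zero_smul]; rfl⟩
    · obtain ⟨e, he⟩ := hc i N
      obtain ⟨m, hm⟩ := ChartBall.exists_clm_eq_primitive (V := V)
        (hρ i (subset_tsupport _ hi))
      exact ⟨ρ i y • (e + m), fun θ hθ ↦ by rw [he θ hθ, ← hm]; rfl⟩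
  choose l hl using hl
  have hfin : {i | ρ i y ≠ 0}.Finite := ρ.locallyFinite.point_finite y
  refine ⟨∑ i ∈ hfin.toFinset, l i, fun θ hθ ↦ ?_⟩
  have h : (support fun i ↦ ρ i y • (c i θ + (B i).primitive θ.1 y)) ⊆ hfin.toFinset := by
    intro i hi
    rw [Finite.coe_toFinset]
    exact fun h0 ↦ hi (by simp [h0])
  rw [gluedPrimitive, finsum_eq_sum_of_support_subset _ h, sum_apply]
  exact Finset.sum_congr rfl fun i _ ↦ hl i θ hθ

variable [CompleteSpace V]

theorem contMDiff_gluedPrimitive (hρ : ρ.IsSubordinate fun i ↦ (B i).domain)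
    (θ : CompactOneForm E M V) :
    ContMDiff 𝓘(ℝ, E) 𝓘(ℝ, V) ∞ (gluedPrimitive ρ B c θ) :=
  hρ.contMDiff_finsum_smul (fun i ↦ (B i).isOpen_domain) fun _ _ hy ↦
    (contMDiffAt_const.add (ChartBall.contMDiffAt_primitive hy θ.1)).contMDiffWithinAt

/-- If the values `c i` at the centres recover `f` up to a locally constant function, then so does
the glued primitive of `d f`, since coordinate balls are connected. -/
theorem gluedPrimitive_differential (hρ : ρ.IsSubordinate fun i ↦ (B i).domain)
    {g : CompactFunction E M V → M → V} (hg : ∀ f, IsLocallyConstant (g f))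
    (hc : ∀ i f, c i (differential E M V f) = f.1 (B i).point - g f (B i).point)
    (f : CompactFunction E M V) (y : M) :
    gluedPrimitive ρ B c (differential E M V f) y = f.1 y - g f y := by
  have h : ∀ i, ρ i y • (c i (differential E M V f) +
      (B i).primitive (differential E M V f).1 y) = ρ i y • (f.1 y - g f y) := by
    intro i
    by_cases hi : ρ i y = 0
    · rw [hi, zero_smul, zero_smul]
    · have hyi : y ∈ (B i).domain := hρ i (subset_tsupport _ hi)
      have h1 : (B i).primitive (differential E M V f).1 y = f.1 y - f.1 (B i).point :=
        ChartBall.primitive_ofFunction hyi f.1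
      have h2 : g f (B i).point = g f y := (hg f).apply_eq_of_isPreconnected
        (B i).isPreconnected_domain (B i).point_mem_domain hyi
      rw [hc, h1, h2]
      congr 1
      abel
  rw [gluedPrimitive, finsum_congr h, ← finsum_smul, ρ.sum_eq_one (mem_univ y), one_smul]

set_option synthInstance.maxHeartbeats 200000 in
/-- The exact forms with compactly supported primitive are the range of a continuous projection. -/
theorem IsSaturatedExhaustive.exists_projection [T2Space M] [SigmaCompactSpace M] {K : ℕ → Set M}
    (hK : IsSaturatedExhaustive E K) :
    ∃ P : CompactOneForm E M V →L[ℝ] CompactOneForm E M V,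
      (∀ θ, P θ ∈ LinearMap.range (differential E M V)) ∧
      ∀ f, P (differential E M V f) = differential E M V f := by
  obtain ⟨B, ρ, hρ, hB⟩ := hK.exists_partition
  obtain ⟨c, g, hg, hcd, hc0, hcK⟩ := hK.exists_functional (V := V)
  have hsupp : ∀ {N : ℕ} {θ : CompactOneForm E M V}, θ.1.support ⊆ K N →
      tsupport (gluedPrimitive ρ B (fun x ↦ c (B x).point) θ) ⊆ K (N + 1) :=
    tsupport_gluedPrimitive_subset hK hρ hB fun x ↦ hc0 (B x).point
  have hcpt : ∀ θ, HasCompactSupport (gluedPrimitive ρ B (fun x ↦ c (B x).point) θ) := fun θ ↦ by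
    obtain ⟨N, hN⟩ := hK.exists_subset θ.2
    exact (hK.isCompactDomain (N + 1)).isCompact.of_isClosed_subset (isClosed_tsupport _)
      (hsupp hN)
  have hclm := exists_clm_eq_gluedPrimitive (c := fun x ↦ c (B x).point) hρ
    fun x ↦ hcK (B x).point
  let F : CompactOneForm E M V → CompactFunction E M V := fun θ ↦
    ⟨⟨_, contMDiff_gluedPrimitive hρ θ⟩, hcpt θ⟩
  have hFlin : ∀ (a : ℝ) (θ η : CompactOneForm E M V), F (a • θ + η) = a • F θ + F η := by
    intro a θ η
    refine Subtype.ext (ContMDiffMap.ext fun y ↦ ?_)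
    obtain ⟨N, hN⟩ := hK.exists_subset (θ.2.union η.2)
    obtain ⟨l, hl⟩ := hclm N y
    have hθ := subset_union_left.trans hN
    have hη := subset_union_right.trans hN
    have hθη : (a • θ + η).1.support ⊆ K N :=
      (OneForm.supportedIn E V (K N)).add_mem
        ((OneForm.supportedIn E V (K N)).smul_mem a hθ) hη
    change gluedPrimitive ρ B _ (a • θ + η) y =
      a • gluedPrimitive ρ B _ θ y + gluedPrimitive ρ B _ η y
    rw [← hl _ hθ, ← hl _ hη, ← hl _ hθη, ← map_smul, ← map_add]
    rfl
  let Φ : CompactOneForm E M V →ₗ[ℝ] CompactFunction E M V :=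
    IsLinearMap.mk' F ⟨fun θ η ↦ by simpa using hFlin 1 θ η, fun a θ ↦ by
      have h0 : F 0 = 0 := by simpa using hFlin 1 0 0
      simpa [h0] using hFlin a θ 0⟩
  refine ⟨⟨differential E M V ∘ₗ Φ, continuous_differential_comp Φ fun C hC ↦ ?_⟩,
    fun θ ↦ ⟨Φ θ, rfl⟩, fun f ↦ ?_⟩
  · obtain ⟨N, hN⟩ := hK.exists_subset hC
    refine ⟨⟨K (N + 1), (hK.isCompactDomain (N + 1)).isCompact,
      fun θ hθ ↦ hsupp (hθ.trans hN)⟩, fun y ↦ ?_⟩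
    obtain ⟨l, hl⟩ := hclm N y
    exact ⟨l, fun θ hθ ↦ hl θ (hθ.trans hN)⟩
  · -- The glued primitive of `d f` and `f` differ by the locally constant function `g f`.
    change differential E M V (F (differential E M V f)) = _
    rw [← sub_eq_zero, ← map_sub]
    refine differential_eq_zero ?_
    have h : ((F (differential E M V f) - f).1 : M → V) = -g f := by
      ext y
      change gluedPrimitive ρ B _ (differential E M V f) y - f.1 y = -g f y
      rw [gluedPrimitive_differential hρ hg (fun x ↦ hcd (B x).point)]
      abel
    rw [h]
    exact (hg f).neg

end Projection

/-! ### Quotients by the range of a projection -/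

section Quotient

variable {X : Type*} [AddCommGroup X] [Module ℝ X] [TopologicalSpace X] {R : Submodule ℝ X}
  {P : X →L[ℝ] X}

/-- A projection `P` onto `R` splits the quotient map `X → X ⧸ R` continuously, by `1 - P`. -/
theorem exists_section_of_projection [IsTopologicalAddGroup X] (hP : ∀ x, P x ∈ R)
    (hPR : ∀ x ∈ R, P x = x) : ∃ s : X ⧸ R →L[ℝ] X, ∀ q, R.mkQ (s q) = q := by
  refine ⟨⟨R.liftQ (LinearMap.id - P.toLinearMap) fun x hx ↦ ?_, ?_⟩, fun q ↦ ?_⟩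
  · rw [LinearMap.mem_ker, LinearMap.sub_apply, sub_eq_zero]
    exact (hPR x hx).symm
  · exact isQuotientMap_quot_mk.continuous_iff.2 (continuous_id.sub P.continuous)
  · obtain ⟨x, rfl⟩ := R.mkQ_surjective q
    refine (Submodule.Quotient.eq R).2 ?_
    change x - P x - x ∈ R
    rw [sub_sub_cancel_left]
    exact R.neg_mem (hP x)

theorem t2Space_quotient_of_projection [IsTopologicalAddGroup X] [T2Space X] (hP : ∀ x, P x ∈ R)
    (hPR : ∀ x ∈ R, P x = x) : T2Space (X ⧸ R) := by
  obtain ⟨s, hs⟩ := exists_section_of_projection hP hPR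
  exact T2Space.of_injective_continuous (LeftInverse.injective hs) s.continuous

theorem completeSpace_quotient_of_projection [IsTopologicalAddGroup X]
    (hX : @CompleteSpace X (IsTopologicalAddGroup.rightUniformSpace X)) (hP : ∀ x, P x ∈ R)
    (hPR : ∀ x ∈ R, P x = x) :
    @CompleteSpace (X ⧸ R) (IsTopologicalAddGroup.rightUniformSpace (X ⧸ R)) := by
  obtain ⟨s, hs⟩ := exists_section_of_projection hP hPR
  let _ : UniformSpace X := IsTopologicalAddGroup.rightUniformSpace X
  have : IsUniformAddGroup X := isUniformAddGroup_of_addCommGroup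
  let _ : UniformSpace (X ⧸ R) := IsTopologicalAddGroup.rightUniformSpace (X ⧸ R)
  have : IsUniformAddGroup (X ⧸ R) := isUniformAddGroup_of_addCommGroup
  refine ⟨fun {F} hF ↦ ?_⟩
  obtain ⟨x, hx⟩ := CompleteSpace.complete (hF.map s.uniformContinuous)
  refine ⟨R.mkQ x, ?_⟩
  have h : Tendsto (fun q ↦ R.mkQ (s q)) F (𝓝 (R.mkQ x)) :=
    (continuous_quot_mk.tendsto x).comp hx
  rwa [show (fun q ↦ R.mkQ (s q)) = id from funext hs] at h

end Quotient

end CompactForms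

end

theorem mainTheorem8
    {E : Type*} [NormedAddCommGroup E] [NormedSpace ℝ E] [FiniteDimensional ℝ E]
    {M : Type*} [TopologicalSpace M] [T2Space M] [SigmaCompactSpace M]
    [ChartedSpace E M] [IsManifold 𝓘(ℝ, E) ∞ M]
    {V : Type*} [NormedAddCommGroup V] [NormedSpace ℝ V] [FiniteDimensional ℝ V]
    (K : ℕ → Set M) (hK : CompactForms.IsSaturatedExhaustive E K) (hstrict : hK.IsStrict) :
    T2Space (CompactForms.CompactOneFormQuotient E M V) ∧
      @CompleteSpace (CompactForms.CompactOneFormQuotient E M V)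
        (IsTopologicalAddGroup.rightUniformSpace (CompactForms.CompactOneFormQuotient E M V)) := by
  have := FiniteDimensional.complete ℝ V
  obtain ⟨P, hP, hPd⟩ := hK.exists_projection (V := V)
  have hPR : ∀ θ ∈ LinearMap.range (CompactForms.differential E M V), P θ = θ := by
    rintro _ ⟨f, rfl⟩
    exact hPd f
  obtain ⟨B, ρ, hρ, hB⟩ := hK.exists_partition
  have hcpt : ∀ x, HasCompactSupport (ρ x) := fun x ↦ by
    obtain ⟨N, hN⟩ := mem_iUnion.1 (hK.iUnion_eq.ge (mem_univ (B x).point))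
    exact (hK.isCompactDomain (N + 1)).isCompact.of_isClosed_subset (isClosed_tsupport _)
      ((hρ x).trans (hB x N ⟨_, (B x).point_mem_domain, hN⟩))
  exact ⟨CompactForms.t2Space_quotient_of_projection hP hPR,
    CompactForms.completeSpace_quotient_of_projection
      (CompactForms.CompactOneForm.completeSpace ρ hcpt) hP hPR⟩
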